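/- Let $N\ge 1$ be an integer and let $S$ be a scheme on which $N$ is invertible. Work with sheaves of abelian groups on the big étale site of $S$ and with their derived mapping spaces: for sheaves $X$, $A$, write $\mathrm{Maps}_{\mathbb Z}(X,B^{(n)}A)$ for the space attached to the complex $\tau^{\le 0}R\mathrm{Hom}(X,A[n])$. A short exact sequence $0\to A\to E\to Q\to 0$ has a coboundary $Q\to B(A)$; a homomorphism $E\to A$ which restricts to $2$ on $A$ is a $2$-torsion structure on it (a trivialization of its double). Consider the following three short exact sequences. * The Kummer sequence $0\to\mu_N\to\mathbb G_m\xrightarrow{N}\mathbb G_m\to 0$. Its coboundary is the Kummer torsor $\Psi:\mathbb G_m\to B(\mu_N)$. * The symmetrized Heisenberg extension $0\to\mathrm{Sym}^2(\mu_N)\to H^{(1)}(\mu_N)\to\mu_N\to 0$: it is $\mathrm{Sym}^2(\mu_N)\times\mu_N$ as a sheaf of sets, with the group law given by the cocycle $(a_1,a_2)\mapsto a_1\otimes a_2$. Its coboundary is $\mathbf H:\mu_N\to B(\mathrm{Sym}^2(\mu_N))\cong B(\mu_N^{\otimes 2})$, where symmetrization $\mu_N^{\otimes 2}\to\mathrm{Sym}^2(\mu_N)$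 is an isomorphism. Its $2$-torsion structure is given by the cochain $a\mapsto a\otimes a$, whose coboundary is $2a_1\otimes a_2$, i.e. by the homomorphism $(z,a)\mapsto 2z-a\otimes a$. * Let $\eta$ be the $\mu_N$-torsor of $N$-th roots of $-1$, let $E_\eta=\{(x,k)\in\mathbb G_m\times\mathbb Z: x^N=(-1)^k\}$ be the corresponding extension of $\mathbb Z$ by $\mu_N$, and consider $0\to\mu_N^{\otimes 2}\to\mu_N\otimes E_\eta\to\mu_N\to 0$. Its coboundary is the Yoneda pairing $\mathbf Y_\eta:\mu_N\to B(\mu_N^{\otimes 2})$, $a\mapsto a\otimes\eta$. Its $2$-torsion structure is inherited from the trivialization of $2\eta$ by the $N$-th root $1$ of $(-1)^2$, i.e. it is given by the homomorphism $a\otimes (x,k)\mapsto a\otimes x^2$. Then these sequences are exact, and there is a canonical isomorphism $$T:\ B(\mathbf H)\circ\Psi\ \cong\ B(\mathbf Y_\eta)\circ\Psi\qquad\text{in } \mathrm{Maps}_{\mathbb Z}(\mathbb G_m,B^{(2)}(\mu_N^{\otimes 2})),$$ together with a canonical isomorphism $R$ between $2\cdot T$ and the identity, where twice the source and twice the target of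 $T$ are trivialized by the $2$-torsion structures induced from those of $\mathbf H$ and $\mathbf Y_\eta$. Here "canonical" means: a pair $(T,R)$ is given for every scheme $S$ on which $N$ is invertible and every choice of representatives of the two composites and of their $2$-torsion structures by cocycles and cochains in an injective resolution of $\mu_N^{\otimes 2}$; and, up to isomorphism of such pairs, it is compatible with all comparisons between choices of representatives and with base change along all morphisms $S'\to S$. -/

import Mathlib

open CategoryTheory AlgebraicGeometry Opposite TensorProduct

universe v u

/-! ## The symmetric square and the symmetrized Heisenberg extension of an abelian group

All abelian groups are written additively. -/

section Groups

variable (A : Type u) [AddCommGroup A]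

/-- The relations `a ⊗ b = b ⊗ a`. -/
def symRel : Submodule ℤ (A ⊗[ℤ] A) :=
  Submodule.span ℤ {t | ∃ a b : A, t = a ⊗ₜ[ℤ] b - b ⊗ₜ[ℤ] a}

/-- `Sym²(A)`: the coinvariants of the swap on `A ⊗ A`. -/
abbrev SymSq : Type u := (A ⊗[ℤ] A) ⧸ symRel A

/-- The symmetrization map `A ⊗ A → Sym²(A)`. -/
def symMap : A ⊗[ℤ] A →+ SymSq A := (symRel A).mkQ.toAddMonoidHom

variable {A}

/-- The product `a · b` in `Sym²(A)`, i.e. the image of `a ⊗ b`. -/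
def symProd (a b : A) : SymSq A := symMap A (a ⊗ₜ[ℤ] b)

theorem symProd_comm (a b : A) : symProd a b = symProd b a := by
  refine (Submodule.Quotient.eq _).2 (Submodule.subset_span ⟨a, b, rfl⟩)

theorem symProd_add_left (a b c : A) : symProd (a + b) c = symProd a c + symProd b c := by
  simp [symProd, TensorProduct.add_tmul]

theorem symProd_add_right (a b c : A) : symProd a (b + c) = symProd a b + symProd a c := by
  simp [symProd, TensorProduct.tmul_add]

theorem symProd_zero_left (a : A) : symProd 0 a = 0 := by simp [symProd]

theorem symProd_zero_right (a : A) : symProd a 0 = 0 := by simp [symProd]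

theorem symProd_neg_left (a b : A) : symProd (-a) b = -symProd a b := by
  simp [symProd, TensorProduct.neg_tmul]

theorem symProd_neg_right (a b : A) : symProd a (-b) = -symProd a b := by
  simp [symProd, TensorProduct.tmul_neg]

variable {B : Type u} [AddCommGroup B]

/-- Functoriality of `A ⊗ A`. -/
def tensorSqMap (f : A →+ B) : A ⊗[ℤ] A →+ B ⊗[ℤ] B :=
  (TensorProduct.map f.toIntLinearMap f.toIntLinearMap).toAddMonoidHom

theorem symRel_le (f : A →+ B) :
    symRel A ≤ (symRel B).comap (TensorProduct.map f.toIntLinearMap f.toIntLinearMap) := by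
  refine Submodule.span_le.2 ?_
  rintro _ ⟨a, b, rfl⟩
  exact Submodule.subset_span ⟨f a, f b, by simp⟩

/-- Functoriality of `Sym²`. -/
def symSqMap (f : A →+ B) : SymSq A →+ SymSq B :=
  ((symRel A).mapQ (symRel B) _ (symRel_le f)).toAddMonoidHom

theorem symSqMap_symMap (f : A →+ B) (t : A ⊗[ℤ] A) :
    symSqMap f (symMap A t) = symMap B (tensorSqMap f t) := rfl

theorem symSqMap_symProd (f : A →+ B) (a b : A) :
    symSqMap f (symProd a b) = symProd (f a) (f b) := rfl

theorem tensor_hom_ext {D : Type*} [AddCommGroup D] {B : Type*} [AddCommGroup B]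
    {g h : A ⊗[ℤ] B →+ D}
    (w : ∀ a b, g (a ⊗ₜ b) = h (a ⊗ₜ b)) : g = h := by
  ext t
  induction t with
  | zero => simp
  | tmul a b => exact w a b
  | add x y hx hy => simp [hx, hy]

theorem symSq_hom_ext {D : Type*} [AddCommGroup D] {g h : SymSq A →+ D}
    (w : ∀ a b, g (symProd a b) = h (symProd a b)) : g = h := by
  have : g.comp (symMap A) = h.comp (symMap A) := tensor_hom_ext w
  ext t
  obtain ⟨s, rfl⟩ := Submodule.mkQ_surjective _ t
  exact DFunLike.congr_fun this s

variable (A)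

/-- `H⁽¹⁾(A)`: the Heisenberg extension of `A × A` by `A ⊗ A`, given by the cocycle
`(a₁, b₁), (a₂, b₂) ↦ b₁ ⊗ a₂`, restricted to the diagonal `A ⊆ A × A` and pushed out along
`A ⊗ A → Sym²(A)`. As a set it is `Sym²(A) × A`. -/
@[ext]
structure Heis where
  z : SymSq A
  x : A

variable {A}

namespace Heis

instance : Zero (Heis A) := ⟨⟨0, 0⟩⟩
instance : Add (Heis A) := ⟨fun s t => ⟨s.z + t.z + symProd s.x t.x, s.x + t.x⟩⟩
instance : Neg (Heis A) := ⟨fun s => ⟨-s.z + symProd s.x s.x, -s.x⟩⟩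

@[simp] theorem zero_z : (0 : Heis A).z = 0 := rfl
@[simp] theorem zero_x : (0 : Heis A).x = 0 := rfl
@[simp] theorem add_z (s t : Heis A) : (s + t).z = s.z + t.z + symProd s.x t.x := rfl
@[simp] theorem add_x (s t : Heis A) : (s + t).x = s.x + t.x := rfl
@[simp] theorem neg_z (s : Heis A) : (-s).z = -s.z + symProd s.x s.x := rfl
@[simp] theorem neg_x (s : Heis A) : (-s).x = -s.x := rfl

instance : AddCommGroup (Heis A) where
  add_assoc a b c := by
    ext
    · simp only [add_z, add_x, symProd_add_left, symProd_add_right]; abel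
    · simp only [add_x]; abel
  zero_add a := by ext <;> simp [symProd_zero_left]
  add_zero a := by ext <;> simp [symProd_zero_right]
  add_comm a b := by
    ext
    · simp only [add_z, symProd_comm a.x b.x]; abel
    · simp only [add_x]; abel
  neg_add_cancel a := by
    ext
    · simp only [add_z, neg_z, neg_x, zero_z, symProd_neg_left]; abel
    · simp
  nsmul := nsmulRec
  zsmul := zsmulRec

variable (A)

/-- `Sym²(A) → H⁽¹⁾(A)`. -/
def incl : SymSq A →+ Heis A where
  toFun z := ⟨z, 0⟩
  map_zero' := rfl
  map_add' a b := by ext <;> simp [symProd_zero_left]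

/-- `H⁽¹⁾(A) → A`. -/
def proj : Heis A →+ A where
  toFun := x
  map_zero' := rfl
  map_add' _ _ := rfl

/-- The trivialization of the pushout of `H⁽¹⁾(A)` along `2 : Sym²(A) → Sym²(A)` given by the
`1`-cochain `a ↦ a · a`, whose coboundary is the doubled cocycle `2 (a₁ · a₂)`: the
homomorphism `H⁽¹⁾(A) → Sym²(A)`, `(z, a) ↦ 2 z - a · a`, which restricts to `2` on
`Sym²(A)`. -/
def retr : Heis A →+ SymSq A where
  toFun s := (2 : ℕ) • s.z - symProd s.x s.x
  map_zero' := by simp [symProd_zero_left]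
  map_add' s t := by
    simp only [add_z, add_x, symProd_add_left, symProd_add_right, symProd_comm t.x s.x]; abel

theorem retr_incl (z : SymSq A) : retr A (incl A z) = (2 : ℕ) • z := by
  simp [retr, incl, symProd_zero_left]

variable {A}

/-- Functoriality of `H⁽¹⁾`. -/
def map (f : A →+ B) : Heis A →+ Heis B where
  toFun s := ⟨symSqMap f s.z, f s.x⟩
  map_zero' := by ext <;> simp
  map_add' s t := by ext <;> simp [symSqMap_symProd]

end Heis

end Groups

/-! ## The groups attached to a commutative ring -/

section Rings

variable (N : ℕ) (R : Type u) [CommRing R]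

/-- `μ_N(R)`, the `N`-torsion of the unit group `Rˣ` (written additively). -/
def rootsSub : AddSubgroup (Additive Rˣ) where
  carrier := {x | N • x = 0}
  zero_mem' := by simp
  add_mem' {a b} ha hb := by
    change N • (a + b) = 0
    rw [nsmul_add, show N • a = 0 from ha, show N • b = 0 from hb, add_zero]
  neg_mem' {a} ha := by
    change N • (-a) = 0
    rw [neg_nsmul, show N • a = 0 from ha, neg_zero]

/-- The extension of `ℤ` by `μ_N` which classifies the torsor `η` of `N`-th roots of `-1`: pairs
`(x, k)` of a unit `x` and an integer `k` with `x ^ N = (-1) ^ k`. The fibre over `k = 1` is the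
torsor of `N`-th roots of `-1`. -/
def etaSub : AddSubgroup (Additive Rˣ × ℤ) where
  carrier := {e | N • e.1 = e.2 • Additive.ofMul (-1 : Rˣ)}
  zero_mem' := by simp
  add_mem' {a b} ha hb := by
    change N • (a.1 + b.1) = (a.2 + b.2) • Additive.ofMul (-1 : Rˣ)
    rw [nsmul_add, add_zsmul, show N • a.1 = _ from ha, show N • b.1 = _ from hb]
  neg_mem' {a} ha := by
    change N • (-a.1) = (-a.2) • Additive.ofMul (-1 : Rˣ)
    rw [neg_nsmul, neg_zsmul, show N • a.1 = _ from ha]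

variable {R} {R' : Type u} [CommRing R']

/-- Functoriality of the unit group. -/
def unitsMap (f : R →+* R') : Additive Rˣ →+ Additive R'ˣ :=
  MonoidHom.toAdditive (Units.map (f : R →* R'))

theorem unitsMap_neg_one (f : R →+* R') :
    unitsMap f (Additive.ofMul (-1 : Rˣ)) = Additive.ofMul (-1 : R'ˣ) := by
  apply Additive.toMul.injective
  ext
  simp [unitsMap]

/-- Functoriality of `μ_N`. -/
def rootsMap (f : R →+* R') : rootsSub N R →+ rootsSub N R' where
  toFun x := ⟨unitsMap f x.1, by
    change N • unitsMap f x.1 = 0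
    rw [← map_nsmul, show N • x.1 = 0 from x.2, map_zero]⟩
  map_zero' := Subtype.ext (map_zero (unitsMap f))
  map_add' a b := Subtype.ext (map_add (unitsMap f) a.1 b.1)

/-- Functoriality of the extension which classifies `η`. -/
def etaMap (f : R →+* R') : etaSub N R →+ etaSub N R' where
  toFun x := ⟨(unitsMap f x.1.1, x.1.2), by
    change N • unitsMap f x.1.1 = x.1.2 • Additive.ofMul (-1 : R'ˣ)
    rw [← map_nsmul, show N • x.1.1 = x.1.2 • Additive.ofMul (-1 : Rˣ) from x.2, map_zsmul,
      unitsMap_neg_one]⟩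
  map_zero' := Subtype.ext (Prod.ext (map_zero (unitsMap f)) rfl)
  map_add' a b := Subtype.ext (Prod.ext (map_add (unitsMap f) a.1.1 b.1.1) rfl)

variable (R)

/-- The `N`-th power map of the unit group. -/
def powHom : Additive Rˣ →+ Additive Rˣ := nsmulAddMonoidHom N

/-- `μ_N → E_η`, `x ↦ (x, 0)`. -/
def etaIncl : rootsSub N R →+ etaSub N R where
  toFun x := ⟨(x.1, 0), by
    change N • x.1 = (0 : ℤ) • _
    rw [zero_smul]; exact x.2⟩
  map_zero' := rfl
  map_add' _ _ := rfl

/-- `E_η → ℤ`, `(x, k) ↦ k`. -/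
def etaProj : etaSub N R →+ ℤ := (AddMonoidHom.snd _ _).comp (etaSub N R).subtype

/-- The trivialization of `2 η` given by the `N`-th root `1` of `(-1) ^ 2 = 1`, that is, by the
element `(1, 2)` of `E_η`: the homomorphism `E_η → μ_N` which sends `e = (x, k)` to
`2 e - k (1, 2) = (x ^ 2, 0)`. It restricts to `2` on `μ_N`. -/
def etaRetr : etaSub N R →+ rootsSub N R where
  toFun e := ⟨(2 : ℕ) • e.1.1, by
    change N • ((2 : ℕ) • e.1.1) = 0
    have h : (2 : ℕ) • Additive.ofMul (-1 : Rˣ) = 0 := by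
      apply Additive.toMul.injective
      simp
    rw [nsmul_left_comm, show N • e.1.1 = e.1.2 • Additive.ofMul (-1 : Rˣ) from e.2,
      ← natCast_zsmul, zsmul_comm, natCast_zsmul, h, zsmul_zero]⟩
  map_zero' := Subtype.ext (nsmul_zero 2)
  map_add' a b := Subtype.ext (nsmul_add a.1.1 b.1.1 2)

/-- `E_Y = μ_N ⊗ E_η`, as an extension of `μ_N = μ_N ⊗ ℤ` by `μ_N ⊗ μ_N`. Its fibre over `a` is
the torsor `a ⊗ η`, the pushout of `η` along `a ⊗ (-) : μ_N → μ_N ⊗ μ_N`. -/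
abbrev YonGrp : Type u := rootsSub N R ⊗[ℤ] etaSub N R

/-- `μ_N ⊗ μ_N → E_Y`. -/
def yonIncl : rootsSub N R ⊗[ℤ] rootsSub N R →+ YonGrp N R :=
  ((etaIncl N R).toIntLinearMap.lTensor (rootsSub N R)).toAddMonoidHom

/-- `E_Y → μ_N`, `a ⊗ (x, k) ↦ k • a`. -/
def yonProj : YonGrp N R →+ rootsSub N R :=
  ((TensorProduct.rid ℤ (rootsSub N R)).toLinearMap ∘ₗ
    (etaProj N R).toIntLinearMap.lTensor (rootsSub N R)).toAddMonoidHom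

/-- The trivialization of twice the extension `E_Y` inherited from that of `2 η`:
`a ⊗ (x, k) ↦ a ⊗ x ^ 2`, which restricts to `2` on `μ_N ⊗ μ_N`. -/
def yonRetr : YonGrp N R →+ rootsSub N R ⊗[ℤ] rootsSub N R :=
  ((etaRetr N R).toIntLinearMap.lTensor (rootsSub N R)).toAddMonoidHom

theorem yonRetr_yonIncl (t : rootsSub N R ⊗[ℤ] rootsSub N R) :
    yonRetr N R (yonIncl N R t) = (2 : ℕ) • t := by
  have : (yonRetr N R).comp (yonIncl N R) = nsmulAddMonoidHom 2 := by
    refine tensor_hom_ext fun a b => ?_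
    have hb : etaRetr N R (etaIncl N R b) = (2 : ℕ) • b := rfl
    simp [yonRetr, yonIncl, hb]
  exact DFunLike.congr_fun this t

variable {R}

/-- Functoriality of `E_Y`. -/
def yonMap (f : R →+* R') : YonGrp N R →+ YonGrp N R' :=
  (TensorProduct.map (rootsMap N f).toIntLinearMap (etaMap N f).toIntLinearMap).toAddMonoidHom

end Rings

/-! ## The same, as functors of the ring -/

noncomputable section Functors

/-- `R ↦ Rˣ`. -/
def gmFun : CommRingCat.{u} ⥤ AddCommGrpCat.{u} where
  obj R := AddCommGrpCat.of (Additive Rˣ)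
  map f := AddCommGrpCat.ofHom (unitsMap f.hom)

variable (N : ℕ)

/-- `R ↦ μ_N(R)`. -/
def muFun : CommRingCat.{u} ⥤ AddCommGrpCat.{u} where
  obj R := AddCommGrpCat.of (rootsSub N R)
  map f := AddCommGrpCat.ofHom (rootsMap N f.hom)
  map_id R := by
    ext1; refine AddMonoidHom.ext fun x => ?_; rfl
  map_comp f g := by
    ext1; refine AddMonoidHom.ext fun x => ?_; rfl

/-- `A ↦ A ⊗ A`. -/
def tensorSqFun : AddCommGrpCat.{u} ⥤ AddCommGrpCat.{u} where
  obj A := AddCommGrpCat.of (A ⊗[ℤ] A)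
  map f := AddCommGrpCat.ofHom (tensorSqMap f.hom)
  map_id A := by
    ext1; refine tensor_hom_ext fun a b => ?_; simp [tensorSqMap]
  map_comp f g := by
    ext1; refine tensor_hom_ext fun a b => ?_; simp [tensorSqMap]

/-- `A ↦ Sym²(A)`. -/
def symSqFun : AddCommGrpCat.{u} ⥤ AddCommGrpCat.{u} where
  obj A := AddCommGrpCat.of (SymSq A)
  map f := AddCommGrpCat.ofHom (symSqMap f.hom)
  map_id A := by
    ext1; refine symSq_hom_ext fun a b => ?_; simp [symSqMap_symProd]
  map_comp f g := by
    ext1; refine symSq_hom_ext fun a b => ?_; simp [symSqMap_symProd]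

theorem symSqMap_id (A : AddCommGrpCat.{u}) (z : SymSq A) :
    symSqMap (AddMonoidHom.id A) z = z :=
  ConcreteCategory.congr_hom (symSqFun.map_id A) z

theorem symSqMap_comp {A B D : AddCommGrpCat.{u}} (f : A ⟶ B) (g : B ⟶ D) (z : SymSq A) :
    symSqMap (g.hom.comp f.hom) z = symSqMap g.hom (symSqMap f.hom z) :=
  ConcreteCategory.congr_hom (symSqFun.map_comp f g) z

/-- `A ↦ H⁽¹⁾(A)`. -/
def heisFun : AddCommGrpCat.{u} ⥤ AddCommGrpCat.{u} where
  obj A := AddCommGrpCat.of (Heis A)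
  map f := AddCommGrpCat.ofHom (Heis.map f.hom)
  map_id A := by
    ext1; refine AddMonoidHom.ext fun s => ?_
    exact Heis.ext (symSqMap_id A s.z) rfl
  map_comp f g := by
    ext1; refine AddMonoidHom.ext fun s => ?_
    exact Heis.ext (symSqMap_comp f g s.z) rfl

/-- `R ↦ μ_N(R) ⊗ E_η(R)`. -/
def yonFun : CommRingCat.{u} ⥤ AddCommGrpCat.{u} where
  obj R := AddCommGrpCat.of (YonGrp N R)
  map f := AddCommGrpCat.ofHom (yonMap N f.hom)
  map_id R := by
    ext1; refine tensor_hom_ext fun a b => ?_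
    change rootsMap N (RingHom.id R) a ⊗ₜ etaMap N (RingHom.id R) b = a ⊗ₜ b
    rfl
  map_comp f g := by
    ext1; refine tensor_hom_ext fun a b => ?_
    rfl

/-- `μ_N → 𝔾ₘ`. -/
def muIncl : muFun.{u} N ⟶ gmFun.{u} where
  app R := AddCommGrpCat.ofHom (rootsSub N R).subtype

/-- `N : 𝔾ₘ → 𝔾ₘ`. -/
def gmPow : gmFun.{u} ⟶ gmFun.{u} where
  app R := AddCommGrpCat.ofHom (powHom N R)
  naturality R R' f := by
    ext x; exact (map_nsmul (unitsMap f.hom) N x).symm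

/-- `A ⊗ A → Sym²(A)`. -/
def symNat : tensorSqFun.{u} ⟶ symSqFun.{u} where
  app A := AddCommGrpCat.ofHom (symMap A)

/-- `Sym²(A) → H⁽¹⁾(A)`. -/
def heisIncl : symSqFun.{u} ⟶ heisFun.{u} where
  app A := AddCommGrpCat.ofHom (Heis.incl A)
  naturality A B f := by
    ext z; exact Heis.ext rfl (map_zero f.hom).symm

/-- `H⁽¹⁾(A) → A`. -/
def heisProj : heisFun.{u} ⟶ 𝟭 AddCommGrpCat.{u} where
  app A := AddCommGrpCat.ofHom (Heis.proj A)

/-- The `2`-torsion structure `H⁽¹⁾(A) → Sym²(A)`. -/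
def heisRetr : heisFun.{u} ⟶ symSqFun.{u} where
  app A := AddCommGrpCat.ofHom (Heis.retr A)
  naturality A B f := by
    ext s
    change (2 : ℕ) • symSqMap f.hom s.z - symProd (f.hom s.x) (f.hom s.x) =
      symSqMap f.hom ((2 : ℕ) • s.z - symProd s.x s.x)
    rw [map_sub, map_nsmul, symSqMap_symProd]

/-- `μ_N ⊗ μ_N → μ_N ⊗ E_η`. -/
def yonInclNat : muFun.{u} N ⋙ tensorSqFun ⟶ yonFun.{u} N where
  app R := AddCommGrpCat.ofHom (yonIncl N R)
  naturality R R' f := by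
    ext1; refine tensor_hom_ext fun a b => ?_
    rfl

/-- `μ_N ⊗ E_η → μ_N`. -/
def yonProjNat : yonFun.{u} N ⟶ muFun.{u} N where
  app R := AddCommGrpCat.ofHom (yonProj N R)
  naturality R R' f := by
    ext1; refine tensor_hom_ext fun a b => ?_
    exact (map_zsmul (rootsMap N f.hom) b.1.2 a).symm

/-- The `2`-torsion structure `μ_N ⊗ E_η → μ_N ⊗ μ_N`. -/
def yonRetrNat : yonFun.{u} N ⟶ muFun.{u} N ⋙ tensorSqFun where
  app R := AddCommGrpCat.ofHom (yonRetr N R)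
  naturality R R' f := by
    ext1; refine tensor_hom_ext fun a b => ?_
    change rootsMap N f.hom a ⊗ₜ etaRetr N R' (etaMap N f.hom b) =
      rootsMap N f.hom a ⊗ₜ rootsMap N f.hom (etaRetr N R b)
    congr 1
    ext1
    exact (map_nsmul (unitsMap f.hom) 2 b.1.1).symm

end Functors

/-! ## Mapping spaces

Let `I` be an injective resolution of an object `A` of an abelian category `C`. For an object `X`
of `C`, the space `Maps_ℤ(X, Bⁿ A)` is the one attached by the Dold-Kan correspondence to the
truncation `τ^{≤ 0}` of the complex `Hom(X, I)[n]`. Concretely: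
* its points are the cocycles `X ⟶ Iⁿ`;
* an isomorphism `c ≅ c'` is a morphism `X ⟶ Iⁿ⁻¹` with differential `c - c'`;
* an isomorphism between two such is a morphism `X ⟶ Iⁿ⁻²` whose differential is their difference,
and so on. -/

noncomputable section Mapping

variable {C : Type u} [Category.{v} C] [Abelian C] {A : C}

/-- The augmentation `A ⟶ I⁰`. -/
def augment (I : InjectiveResolution A) : A ⟶ I.cocomplex.X 0 := I.ι.f 0

variable (I : InjectiveResolution A)

/-- A point of `Maps_ℤ(X, Bⁿ A)`. -/
structure MapsPt (X : C) (n : ℕ) where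
  hom : X ⟶ I.cocomplex.X n
  closed : hom ≫ I.cocomplex.d n (n + 1) = 0

/-- A morphism of objects `X ⟶ A` as a point of `Maps_ℤ(X, B⁰ A)`. -/
def MapsPt.ofHom {X : C} (a : X ⟶ A) : MapsPt I X 0 where
  hom := a ≫ augment I
  closed := by
    rw [Category.assoc, show augment I ≫ I.cocomplex.d 0 1 = 0 from I.ι_f_zero_comp_complex_d,
      Limits.comp_zero]

/-- A `2`-torsion structure on a point `c` of `Maps_ℤ(X, Bⁿ⁺¹ A)`: an isomorphism `2 c ≅ 0`. -/
structure TwoTors {X : C} {n : ℕ} (c : MapsPt I X (n + 1)) where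
  htpy : X ⟶ I.cocomplex.X n
  d_htpy : htpy ≫ I.cocomplex.d n (n + 1) = (2 : ℕ) • c.hom

variable {I}

/-- Let `0 ⟶ P ⟶ E ⟶ Q ⟶ 0` be a short exact sequence, with coboundary `∂ : Q ⟶ B P`, and let `c`
be a point of `Maps_ℤ(P, Bⁿ A)`. This is a representative of the composite
`B(c) ∘ ∂ : Q ⟶ B P ⟶ Bⁿ⁺¹ A`, as a point of `Maps_ℤ(Q, Bⁿ⁺¹ A)`: extend `c` to `E ⟶ Iⁿ`, take
the differential of the extension and descend it to `Q`. -/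
structure CobComp {P E Q : C} (i : P ⟶ E) (p : E ⟶ Q) {n : ℕ} (c : MapsPt I P n) where
  lift : E ⟶ I.cocomplex.X n
  incl_lift : i ≫ lift = c.hom
  pt : MapsPt I Q (n + 1)
  proj_pt : p ≫ pt.hom = lift ≫ I.cocomplex.d n (n + 1)

/-- If `ρ : E ⟶ P` restricts to `2` on `P`, it trivializes the pushout of the extension `E` along
`2 : P ⟶ P`, i.e. it is a `2`-torsion structure on `∂`. This is the induced `2`-torsion structure
on `B(c) ∘ ∂`: both `2 • lift` and `ρ ≫ c` extend `2 c` to `E`, and their difference descends to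
`Q`. -/
structure ExtTors {P E Q : C} {i : P ⟶ E} {p : E ⟶ Q} (ρ : E ⟶ P) {n : ℕ} {c : MapsPt I P n}
    (b : CobComp i p c) extends TwoTors I b.pt where
  proj_htpy : p ≫ htpy = (2 : ℕ) • b.lift - ρ ≫ c.hom

/-- The `2`-torsion structure on `B(c) ∘ ∂` induced by a `2`-torsion structure `t` on `c`: extend
`t` to `E`, and descend the difference of `2 • lift` and the differential of this extension. -/
structure WhiskerTors {P E Q : C} {i : P ⟶ E} {p : E ⟶ Q} {n : ℕ} {c : MapsPt I P (n + 1)}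
    (t : TwoTors I c) (b : CobComp i p c) extends TwoTors I b.pt where
  lift : E ⟶ I.cocomplex.X n
  incl_lift : i ≫ lift = t.htpy
  proj_htpy : p ≫ htpy = (2 : ℕ) • b.lift - lift ≫ I.cocomplex.d n (n + 1)

/-- Let `0 ⟶ P ⟶ E ⟶ Q ⟶ 0` be a short exact sequence with coboundary `F : Q ⟶ B P` and with a
`2`-torsion structure `ρ`, let `a` be a point of `Maps_ℤ(P, B⁰ A)`, and let
`0 ⟶ Q ⟶ G ⟶ L ⟶ 0` be a short exact sequence with coboundary `Ψ : L ⟶ B Q`. This is a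
representative of the composite `B²(a) ∘ B(F) ∘ Ψ : L ⟶ B Q ⟶ B² P ⟶ B² A`, with its `2`-torsion
structure induced by `ρ`. -/
structure Composite {P E Q G L : C} (i : P ⟶ E) (p : E ⟶ Q) (ρ : E ⟶ P) (j : Q ⟶ G) (q : G ⟶ L)
    (a : MapsPt I P 0) where
  /-- `B(a) ∘ F : Q ⟶ B A` -/
  ext : CobComp i p a
  extTors : ExtTors ρ ext
  /-- `(B²(a) ∘ B(F)) ∘ Ψ : L ⟶ B² A` -/
  comp : CobComp j q ext.pt
  compTors : WhiskerTors extTors.toTwoTors comp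

/-- An isomorphism between two points of `Maps_ℤ(X, Bⁿ⁺¹ A)`. -/
structure MapsIso {X : C} {n : ℕ} (c c' : MapsPt I X (n + 1)) where
  hom : X ⟶ I.cocomplex.X n
  d_hom : hom ≫ I.cocomplex.d n (n + 1) = c.hom - c'.hom

/-- For an isomorphism `T : c ≅ c'` of points of `Maps_ℤ(X, Bⁿ⁺² A)` and `2`-torsion structures
`t : 2 c ≅ 0` and `t' : 2 c' ≅ 0`: an isomorphism between `2 T` and the identity of `0`, when
`2 c` and `2 c'` are identified with `0` by `t` and `t'`; that is, between `2 T` and `t - t'`. -/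
structure TorsCompat {X : C} {n : ℕ} {c c' : MapsPt I X (n + 2)} (t : TwoTors I c)
    (t' : TwoTors I c') (T : MapsIso c c') where
  hom : X ⟶ I.cocomplex.X n
  d_hom : hom ≫ I.cocomplex.d n (n + 1) = (2 : ℕ) • T.hom - (t.htpy - t'.htpy)

/-- The sequence `0 ⟶ P ⟶ E ⟶ Q ⟶ 0` is exact. -/
def IsShortExact {P E Q : C} (i : P ⟶ E) (p : E ⟶ Q) : Prop :=
  ∃ w : i ≫ p = 0, (ShortComplex.mk i p w).ShortExact

end Mapping

/-! ## The étale sheaves -/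

noncomputable section Sheaves

/-- Sheaves of abelian groups on the big étale site of all schemes. -/
abbrev EtSheaf := Sheaf Scheme.etaleTopology.{u} AddCommGrpCat.{u + 1}

/-- Sheaves of abelian groups on the big étale site of `S`-schemes. -/
abbrev EtSheafOver (S : Scheme.{u}) :=
  Sheaf (Scheme.etaleTopology.{u}.over S) AddCommGrpCat.{u + 1}

/-- The étale sheaf associated to `X ↦ F(Γ(X, 𝒪_X))`. -/
def assocSheaf : (CommRingCat.{u} ⥤ AddCommGrpCat.{u}) ⥤ EtSheaf.{u} :=
  (Functor.whiskeringLeft _ _ _).obj Scheme.Γ ⋙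
    (Functor.whiskeringRight _ _ _).obj AddCommGrpCat.uliftFunctor.{u + 1, u} ⋙
      presheafToSheaf Scheme.etaleTopology.{u} AddCommGrpCat.{u + 1}

/-- Restriction to `S`-schemes. -/
abbrev restrictTo (S : Scheme.{u}) : EtSheaf.{u} ⥤ EtSheafOver S :=
  Scheme.etaleTopology.{u}.overPullback AddCommGrpCat.{u + 1} S

/-- Restriction from `S`-schemes to `S'`-schemes along `f : S' ⟶ S`. -/
abbrev baseChange {S S' : Scheme.{u}} (f : S' ⟶ S) : EtSheafOver S ⥤ EtSheafOver S' :=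
  Scheme.etaleTopology.{u}.overMapPullback AddCommGrpCat.{u + 1} f

/-- For a sheaf `F` on all schemes, a morphism out of `F|_S` restricts to one out of `F|_{S'}`. -/
def bcHom {S S' : Scheme.{u}} (f : S' ⟶ S) {F : EtSheaf.{u}} {Z : EtSheafOver S}
    (m : (restrictTo S).obj F ⟶ Z) : (restrictTo S').obj F ⟶ (baseChange f).obj Z :=
  (F.pushforwardOverMapIso f).inv ≫ (baseChange f).map m

/-- The sheaf on `S`-schemes associated to `X ↦ F(Γ(X, 𝒪_X))`. -/
abbrev shOver (S : Scheme.{u}) (F : CommRingCat.{u} ⥤ AddCommGrpCat.{u}) : EtSheafOver S :=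
  (restrictTo S).obj (assocSheaf.obj F)

/-- The morphism of sheaves on `S`-schemes induced by a natural transformation. -/
abbrev shMap (S : Scheme.{u}) {F F' : CommRingCat.{u} ⥤ AddCommGrpCat.{u}} (α : F ⟶ F') :
    shOver S F ⟶ shOver S F' :=
  (restrictTo S).map (assocSheaf.map α)

variable (N : ℕ) (S : Scheme.{u})

/-- `𝔾ₘ` -/
abbrev Gm : EtSheafOver S := shOver S gmFun
/-- `μ_N` -/
abbrev Mu : EtSheafOver S := shOver S (muFun N)
/-- `μ_N ⊗ μ_N` -/
abbrev Mu2 : EtSheafOver S := shOver S (muFun N ⋙ tensorSqFun)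
/-- `Sym²(μ_N)` -/
abbrev SymMu : EtSheafOver S := shOver S (muFun N ⋙ symSqFun)
/-- `H⁽¹⁾(μ_N)` -/
abbrev HMu : EtSheafOver S := shOver S (muFun N ⋙ heisFun)
/-- `E_Y = μ_N ⊗ E_η` -/
abbrev YMu : EtSheafOver S := shOver S (yonFun N)

/-- The Kummer sequence `μ_N ⟶ 𝔾ₘ ⟶ 𝔾ₘ`, with coboundary the Kummer torsor
`Ψ : 𝔾ₘ ⟶ B(μ_N)`. -/
abbrev kumI : Mu N S ⟶ Gm S := shMap S (muIncl N)
/-- The `N`-th power map `𝔾ₘ ⟶ 𝔾ₘ`. -/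
abbrev kumP : Gm S ⟶ Gm S := shMap S (gmPow N)

/-- The symmetrization map `μ_N ⊗ μ_N ⟶ Sym²(μ_N)`. -/
abbrev symS : Mu2 N S ⟶ SymMu N S := shMap S (Functor.whiskerLeft (muFun N) symNat)

/-- The symmetrized Heisenberg extension `Sym²(μ_N) ⟶ H⁽¹⁾(μ_N) ⟶ μ_N`, with coboundary
`H : μ_N ⟶ B(Sym²(μ_N))`. -/
abbrev heiI : SymMu N S ⟶ HMu N S := shMap S (Functor.whiskerLeft (muFun N) heisIncl)
/-- `H⁽¹⁾(μ_N) ⟶ μ_N`. -/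
abbrev heiP : HMu N S ⟶ Mu N S := shMap S (Functor.whiskerLeft (muFun N) heisProj)
/-- The `2`-torsion structure of `H`. -/
abbrev heiR : HMu N S ⟶ SymMu N S := shMap S (Functor.whiskerLeft (muFun N) heisRetr)

/-- The extension `μ_N ⊗ μ_N ⟶ E_Y ⟶ μ_N`, with coboundary the Yoneda pairing
`Y_η : μ_N ⟶ B(μ_N ⊗ μ_N)`, `a ↦ a ⊗ η`. -/
abbrev yonI : Mu2 N S ⟶ YMu N S := shMap S (yonInclNat N)
/-- `E_Y ⟶ μ_N`. -/
abbrev yonP : YMu N S ⟶ Mu N S := shMap S (yonProjNat N)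
/-- The `2`-torsion structure of `Y_η`, inherited from that of `η`. -/
abbrev yonR : YMu N S ⟶ Mu2 N S := shMap S (yonRetrNat N)

/-- A choice of representatives for the two composites `𝔾ₘ ⟶ B²(μ_N ⊗ μ_N)` over `S`, each with
its `2`-torsion structure. -/
structure ProductRep where
  /-- an injective resolution of `μ_N ⊗ μ_N` over `S` -/
  res : InjectiveResolution (Mu2 N S)
  /-- the identification `μ_N ⊗ μ_N ≅ Sym²(μ_N)` given by symmetrization -/
  sym : Mu2 N S ≅ SymMu N S
  sym_hom : sym.hom = symS N S
  /-- `B(H) ∘ Ψ` -/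
  HΨ : Composite (heiI N S) (heiP N S) (heiR N S) (kumI N S) (kumP N S)
    (MapsPt.ofHom res sym.inv)
  /-- `B(Y_η) ∘ Ψ` -/
  YΨ : Composite (yonI N S) (yonP N S) (yonR N S) (kumI N S) (kumP N S)
    (MapsPt.ofHom res (𝟙 _))

variable {N S}

/-- An isomorphism `T : B(H) ∘ Ψ ≅ B(Y_η) ∘ Ψ` over `S`. -/
abbrev ProductRep.TwoIso (r : ProductRep N S) := MapsIso r.HΨ.comp.pt r.YΨ.comp.pt

/-- An isomorphism between `2 T` and the identity, with respect to the `2`-torsion structures of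
`B(H)` and `B(Y_η)`. -/
abbrev ProductRep.TwoIsoTors (r : ProductRep N S) (T : r.TwoIso) :=
  TorsCompat r.HΨ.compTors.toTwoTors r.YΨ.compTors.toTwoTors T

/-! ### Independence of choices and base change -/

variable {S' : Scheme.{u}} (f : S' ⟶ S)

/-- A comparison of resolutions: a morphism `κ` of complexes from the restriction along `f` of a
resolution over `S` to a resolution over `S'`, which is the identity on `μ_N ⊗ μ_N`. -/
structure ResComparison (I : InjectiveResolution (Mu2 N S))
    (I' : InjectiveResolution (Mu2 N S')) where
  κ : ∀ n : ℕ, (baseChange f).obj (I.cocomplex.X n) ⟶ I'.cocomplex.X n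
  comm : ∀ n : ℕ, (baseChange f).map (I.cocomplex.d n (n + 1)) ≫ κ (n + 1) =
    κ n ≫ I'.cocomplex.d n (n + 1)
  augment_comm : bcHom f (augment I) ≫ κ 0 = augment I'

variable {f}

/-- The canonical isomorphism between the base change of a representative `s` of a composite
(`B(H) ∘ Ψ` or `B(Y_η) ∘ Ψ`) over `S` and a representative `s'` of the same composite over `S'`:
* `u` is the resulting isomorphism between the two representatives of `H` (or `Y_η`), and `x` is
  an extension of it along `μ_N ⟶ 𝔾ₘ`;
* `y` is the resulting isomorphism between the two representatives of the composite;
* `z` is the resulting compatibility of `y` with the `2`-torsion structures. -/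
structure CompositeComparison {I : InjectiveResolution (Mu2 N S)}
    {I' : InjectiveResolution (Mu2 N S')} (k : ResComparison f I I')
    {P E : CommRingCat.{u} ⥤ AddCommGrpCat.{u}} {i : P ⟶ E} {p : E ⟶ muFun N} {ρ : E ⟶ P}
    {a : MapsPt I (shOver S P) 0} {a' : MapsPt I' (shOver S' P) 0}
    (s : Composite (shMap S i) (shMap S p) (shMap S ρ) (kumI N S) (kumP N S) a)
    (s' : Composite (shMap S' i) (shMap S' p) (shMap S' ρ) (kumI N S') (kumP N S') a') where
  u : Mu N S' ⟶ I'.cocomplex.X 0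
  proj_u : shMap S' p ≫ u = bcHom f s.ext.lift ≫ k.κ 0 - s'.ext.lift
  x : Gm S' ⟶ I'.cocomplex.X 0
  incl_x : kumI N S' ≫ x = u
  y : Gm S' ⟶ I'.cocomplex.X 1
  pow_y : kumP N S' ≫ y =
    bcHom f s.comp.lift ≫ k.κ 1 - s'.comp.lift - x ≫ I'.cocomplex.d 0 1
  z : Gm S' ⟶ I'.cocomplex.X 0
  pow_z : kumP N S' ≫ z =
    bcHom f s.compTors.lift ≫ k.κ 0 - s'.compTors.lift - (2 : ℕ) • x

variable (f)

/-- A comparison between the base change of `r` along `f : S' ⟶ S` and `r'`. -/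
structure ProductComparison (r : ProductRep N S) (r' : ProductRep N S') where
  res : ResComparison f r.res r'.res
  HΨ : CompositeComparison res r.HΨ r'.HΨ
  YΨ : CompositeComparison res r.YΨ r'.YΨ

variable {f}

/-- The pair `(T, R)` of an isomorphism `T` over `S` and a compatibility `R` of `T` with the
`2`-torsion structures corresponds to the pair `(T', R')` over `S'`: after base change and
transport along the comparison `k`, the first pair becomes isomorphic to the second. -/
def ProductComparison.Matches {r : ProductRep N S} {r' : ProductRep N S'} (k : ProductComparison f r r')
    {T : r.TwoIso} (R : r.TwoIsoTors T) {T' : r'.TwoIso} (R' : r'.TwoIsoTors T') : Prop :=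
  ∃ w : Gm S' ⟶ r'.res.cocomplex.X 0,
    w ≫ r'.res.cocomplex.d 0 1 =
      (bcHom f T.hom ≫ k.res.κ 1 - k.HΨ.y + k.YΨ.y) - T'.hom ∧
    (2 : ℕ) • w = (bcHom f R.hom ≫ k.res.κ 0 - k.HΨ.z + k.YΨ.z) - R'.hom

end Sheaves

/-!
Write `H` and `Y` for the Heisenberg extension and for `μ_N ⊗ E_η`, two extensions of `μ_N` by
`μ_N ⊗ μ_N ≅ Sym²(μ_N)` with `2`-torsion structures. In terms of the exact sequence
`0 ⟶ μ_N ⟶ 𝔾ₘ ⟶ 𝔾ₘ ⟶ 0`, an isomorphism `T : B(H) ∘ Ψ ≅ B(Y) ∘ Ψ` is given by an extension of `𝔾ₘ`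
by `μ_N ⊗ μ_N` together with an isomorphism of its restriction to `μ_N` with the difference of `H` and
`Y`. Local computation shows which one to take. The extension `Y` is killed by `N`, while `N` times
the lift `(0, a)` of `a` to `H` is `φ(a) = (N choose 2) a · a` (`nsmul_heis`). Here `φ` is a
homomorphism with `2 φ = 0` (`halfSq`), and the extension of `𝔾ₘ` has to be the pushout along `φ` of
the Kummer sequence.

The isomorphism of `H - Y` with the restriction of this pushout can be written down on a primitive
`N²`-th root of unity `b`. Put `ζ = b ^ N`. Then `ξ = -b ^ (N choose 2)` is an `N`-th root of `-1`
with `ξ² = ζ⁻¹`, and the lifts `(0, ζ)` to `H`, `ζ ⊗ ξ` to `Y` and `b` to the Kummer sequence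
correspond to each other. This is compatible with the `2`-torsion structures, because
`2 · 0 - ζ ⊗ ζ = ζ ⊗ ξ²` (`RootGen.etaRetr_eta`). It does not depend on the choice of `b`: for
`b' = b ^ k` the three lifts differ from the `k`-fold ones by `-(k choose 2) ζ ⊗ ζ`, by the same
element, and by `0` (`sub_mem_relSub`); and the `N`-fold lifts are `φ(ζ)`, `0` and `ζ`
(`nsmul_mem_relSub`). To glue these local isomorphisms, `μ_N` is presented as the cokernel of a
morphism of sheaves `relSub ⟶ GenGrp`, where `GenGrp` is the free abelian group on the roots of
unity `b` as above and `relSub` encodes which differences of lifts are allowed (`epi_genMu`,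
`exact_relGen_genMu`).

Everything is defined for rings, functorially, so the compatibility with base change is automatic.
Exactness is checked étale-locally on rings, where there are enough roots of unity
(`etaleLocally_exists_isRoot_cyclotomic`, `etaleLocally_exists_eq_pow`); this also gives the
exactness of the three sequences and the bijectivity of the symmetrization.

Given representatives in an injective resolution, `T` and `R` are obtained by extending and
descending morphisms (`nonempty_trivData`), and an analogous diagram chase compares the results for
two choices of representatives and two choices of extensions (`TrivData.exists_comparison`).
-/

/-! ### Étale neighbourhoods and sections of associated sheaves -/

/-- The property `P` of ring homomorphisms out of `R` holds on an étale neighbourhood of every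
point of `Spec R`. -/
def EtaleLocally (R : CommRingCat.{u}) (P : ∀ R' : CommRingCat.{u}, (R ⟶ R') → Prop) : Prop :=
  ∀ p : PrimeSpectrum R, ∃ (R' : CommRingCat.{u}) (f : R ⟶ R'),
    f.hom.Etale ∧ (∃ p' : PrimeSpectrum R', PrimeSpectrum.comap f.hom p' = p) ∧ P R' f

namespace EtaleLocally

variable {R : CommRingCat.{u}} {P Q : ∀ R' : CommRingCat.{u}, (R ⟶ R') → Prop}

theorem of_id (h : P R (𝟙 R)) : EtaleLocally R P := fun p =>
  ⟨R, 𝟙 R, RingHom.Etale.containsIdentities R, ⟨p, rfl⟩, h⟩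

theorem bind (h : EtaleLocally R P)
    (hQ : ∀ (R' : CommRingCat.{u}) (f : R ⟶ R'), P R' f →
      EtaleLocally R' fun R'' g => Q R'' (f ≫ g)) : EtaleLocally R Q := by
  intro p
  obtain ⟨R₁, f, hf, ⟨p₁, hp₁⟩, h₁⟩ := h p
  obtain ⟨R₂, g, hg, ⟨p₂, hp₂⟩, h₂⟩ := hQ R₁ f h₁ p₁
  refine ⟨R₂, f ≫ g, RingHom.Etale.stableUnderComposition f.hom g.hom hf hg, ⟨p₂, ?_⟩, h₂⟩
  rw [← hp₁, ← hp₂]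
  rfl

theorem mono (h : EtaleLocally R P)
    (hQ : ∀ (R' : CommRingCat.{u}) (f : R ⟶ R'), P R' f → Q R' f) : EtaleLocally R Q :=
  h.bind fun R' f hP => of_id (by simpa using hQ R' f hP)

end EtaleLocally

/-- The morphisms `Y ⟶ X` for which `Γ(X) ⟶ Γ(Y)` factors through some `Γ(X) ⟶ R'` with
property `P`. -/
def ringSieve (X : Scheme.{u}) (P : ∀ R' : CommRingCat.{u}, (Γ(X, ⊤) ⟶ R') → Prop) :
    Sieve X where
  arrows Y g := ∃ (R' : CommRingCat.{u}) (f : Γ(X, ⊤) ⟶ R') (h : R' ⟶ Γ(Y, ⊤)),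
    f ≫ h = g.appTop ∧ P R' f
  downward_closed := by
    rintro Y Z g ⟨R', f, h, hfh, hP⟩ k
    exact ⟨R', f, h ≫ k.appTop, by rw [← Category.assoc, hfh, Scheme.Hom.comp_appTop], hP⟩

theorem EtaleLocally.ringSieve_mem {X : Scheme.{u}}
    {P : ∀ R' : CommRingCat.{u}, (Γ(X, ⊤) ⟶ R') → Prop} (h : EtaleLocally Γ(X, ⊤) P) :
    ringSieve X P ∈ Scheme.etaleTopology.{u} X := by
  refine Scheme.mem_grothendieckTopology_iff.2 ?_
  have h' : ∀ x : X, ∃ (R' : CommRingCat.{u}) (f : Γ(X, ⊤) ⟶ R'),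
      f.hom.Etale ∧ (∃ p', PrimeSpectrum.comap f.hom p' = X.toSpecΓ x) ∧ P R' f :=
    fun x => h (X.toSpecΓ x)
  choose R' f hf hp hP using h'
  choose p' hp' using hp
  have het : ∀ x, Etale (Spec.map (f x)) := fun x =>
    (HasRingHomProperty.Spec_iff (P := @Etale)).2 (hf x)
  have hpt : ∀ x : X, ∃ y : ↥(Limits.pullback X.toSpecΓ (Spec.map (f x))),
      Limits.pullback.fst X.toSpecΓ (Spec.map (f x)) y = x := fun x => by
    obtain ⟨y, hy, -⟩ := Scheme.Pullback.exists_preimage_pullback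
      (f := X.toSpecΓ) (g := Spec.map (f x)) x (p' x) (hp' x).symm
    exact ⟨y, hy⟩
  have hΓ : ∀ x : X, f x ≫ (Scheme.ΓSpecIso (R' x)).inv ≫
      (Limits.pullback.snd X.toSpecΓ (Spec.map (f x))).appTop =
      (Limits.pullback.fst X.toSpecΓ (Spec.map (f x))).appTop := fun x => by
    rw [← Category.assoc, Scheme.ΓSpecIso_inv_naturality, Category.assoc,
      ← Scheme.Hom.comp_appTop, ← Limits.pullback.condition, Scheme.Hom.comp_appTop,
      Scheme.toSpecΓ_appTop, Iso.inv_hom_id_assoc]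
  refine ⟨Scheme.Cover.mkOfCovers X
    (fun x : X => Limits.pullback X.toSpecΓ (Spec.map (f x)))
    (fun x => Limits.pullback.fst _ _) (fun x => ⟨x, hpt x⟩) (fun x => ?_), ?_⟩
  · have := het x
    exact inferInstanceAs (Etale (Limits.pullback.fst X.toSpecΓ (Spec.map (f x))))
  · rintro _ _ ⟨x⟩
    exact ⟨R' x, f x, _, hΓ x, hP x⟩

noncomputable section

/-- The section of the étale sheaf associated to `X ↦ F(Γ(X))` given by an element of
`F(Γ(X))`. -/
def sec (F : CommRingCat.{u} ⥤ AddCommGrpCat.{u}) (X : Scheme.{u}) :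
    F.obj Γ(X, ⊤) →+ (assocSheaf.obj F).obj.obj (op X) :=
  ((toSheafify Scheme.etaleTopology.{u}
    (Scheme.Γ ⋙ F ⋙ AddCommGrpCat.uliftFunctor.{u + 1, u})).app (op X)).hom.comp
      AddEquiv.ulift.symm.toAddMonoidHom

variable {F G H : CommRingCat.{u} ⥤ AddCommGrpCat.{u}}

theorem sec_restrict {X Y : Scheme.{u}} (g : Y ⟶ X) (x : F.obj Γ(X, ⊤)) :
    (assocSheaf.obj F).obj.map g.op (sec F X x) = sec F Y (F.map g.appTop x) :=
  (ConcreteCategory.congr_hom ((toSheafify Scheme.etaleTopology.{u}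
    (Scheme.Γ ⋙ F ⋙ AddCommGrpCat.uliftFunctor.{u + 1, u})).naturality g.op) _).symm

theorem sec_map (α : F ⟶ G) {X : Scheme.{u}} (x : F.obj Γ(X, ⊤)) :
    (assocSheaf.map α).hom.app (op X) (sec F X x) = sec G X (α.app _ x) :=
  (ConcreteCategory.congr_hom (congr_app (toSheafify_naturality Scheme.etaleTopology.{u}
    (Functor.whiskerLeft Scheme.Γ (Functor.whiskerRight α AddCommGrpCat.uliftFunctor.{u + 1, u})))
    (op X)) _).symm

theorem exists_sec_restrict {X : Scheme.{u}} (s : (assocSheaf.obj F).obj.obj (op X)) :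
    ∃ T ∈ Scheme.etaleTopology.{u} X, ∀ {Y : Scheme.{u}} (g : Y ⟶ X), T g →
      ∃ x, sec F Y x = (assocSheaf.obj F).obj.map g.op s := by
  refine ⟨_, Presheaf.imageSieve_mem Scheme.etaleTopology.{u}
    (toSheafify Scheme.etaleTopology.{u}
      (Scheme.Γ ⋙ F ⋙ AddCommGrpCat.uliftFunctor.{u + 1, u})) s, ?_⟩
  rintro Y g ⟨t, ht⟩
  exact ⟨t.down, ht⟩

theorem exists_restrict_eq_zero {X : Scheme.{u}} (x : F.obj Γ(X, ⊤)) (hx : sec F X x = 0) :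
    ∃ T ∈ Scheme.etaleTopology.{u} X, ∀ {Y : Scheme.{u}} (g : Y ⟶ X), T g →
      F.map g.appTop x = 0 := by
  refine ⟨_, Presheaf.equalizerSieve_mem Scheme.etaleTopology.{u}
    (toSheafify Scheme.etaleTopology.{u}
      (Scheme.Γ ⋙ F ⋙ AddCommGrpCat.uliftFunctor.{u + 1, u})) (X := op X) (ULift.up x) 0
      (hx.trans (map_zero _).symm), ?_⟩
  intro Y g hg
  exact congrArg ULift.down (hg.trans (map_zero _))

end

/-! ### Local criteria for exactness, and base change -/

noncomputable section

variable {F G H : CommRingCat.{u} ⥤ AddCommGrpCat.{u}}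

theorem isUnit_natCast_of_hom {R R' : CommRingCat.{u}} (f : R ⟶ R') {N : ℕ}
    (h : IsUnit (N : R)) : IsUnit (N : R') := by
  simpa using h.map f.hom

/-- A section of an associated sheaf is locally given by elements, so a sieve covers as soon as
its pullbacks to the places where the section is given by an element do. -/
theorem mem_of_sec {X : Scheme.{u}} (s : (assocSheaf.obj F).obj.obj (op X)) (T : Sieve X)
    (hT : ∀ {Y : Scheme.{u}} (g : Y ⟶ X) (x : F.obj Γ(Y, ⊤)),
      sec F Y x = (assocSheaf.obj F).obj.map g.op s → T.pullback g ∈ Scheme.etaleTopology.{u} Y) :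
    T ∈ Scheme.etaleTopology.{u} X := by
  obtain ⟨T₀, hT₀, h₀⟩ := exists_sec_restrict s
  refine Scheme.etaleTopology.{u}.transitive hT₀ T fun Y g hg => ?_
  obtain ⟨x, hx⟩ := h₀ g hg
  exact hT g x hx

variable {N : ℕ} {X : Scheme.{u}}

theorem restrict_comp {Y Z : Scheme.{u}} (g : Y ⟶ X) (k : Z ⟶ Y)
    (s : (assocSheaf.obj F).obj.obj (op X)) :
    (assocSheaf.obj F).obj.map (k ≫ g).op s =
      (assocSheaf.obj F).obj.map k.op ((assocSheaf.obj F).obj.map g.op s) := by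
  rw [op_comp, Functor.map_comp]
  rfl

theorem restrict_map (α : F ⟶ G) {Y : Scheme.{u}} (g : Y ⟶ X)
    (s : (assocSheaf.obj F).obj.obj (op X)) :
    (assocSheaf.map α).hom.app (op Y) ((assocSheaf.obj F).obj.map g.op s) =
      (assocSheaf.obj G).obj.map g.op ((assocSheaf.map α).hom.app (op X) s) :=
  ConcreteCategory.congr_hom ((assocSheaf.map α).hom.naturality g.op) s

/-- The exactness of `F ⟶ G ⟶ H` at `G` for associated étale sheaves on schemes on which `N` is
invertible, when it holds étale-locally for rings. -/
theorem imageSieve_mem_of_exact (hX : IsUnit (N : Γ(X, ⊤))) (α : F ⟶ G) (β : G ⟶ H)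
    (h : ∀ R : CommRingCat.{u}, IsUnit (N : R) → ∀ y : G.obj R, β.app R y = 0 →
      EtaleLocally R fun R' f => ∃ x, α.app R' x = G.map f y)
    (s : (assocSheaf.obj G).obj.obj (op X)) (hs : (assocSheaf.map β).hom.app (op X) s = 0) :
    Presheaf.imageSieve (assocSheaf.map α).hom s ∈ Scheme.etaleTopology.{u} X := by
  refine mem_of_sec s _ fun {Y} g y hy => ?_
  have h0 : sec H Y (β.app _ y) = 0 := by
    rw [← sec_map, hy, restrict_map, hs, map_zero]
  obtain ⟨T, hT, hT0⟩ := exists_restrict_eq_zero _ h0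
  refine Scheme.etaleTopology.{u}.transitive hT _ fun Z k hk => ?_
  have hloc := h Γ(Z, ⊤) (isUnit_natCast_of_hom (k ≫ g).appTop hX) (G.map k.appTop y)
    ((ConcreteCategory.congr_hom (β.naturality k.appTop) y).trans (hT0 k hk))
  refine Scheme.etaleTopology.{u}.superset_covering ?_ hloc.ringSieve_mem
  rintro Z' l ⟨R', f, q, hfq, x, hx⟩
  refine ⟨sec F Z' (F.map q x), ?_⟩
  rw [sec_map, restrict_comp, restrict_comp, ← hy, sec_restrict, sec_restrict, ← hfq]
  congr 1
  have h1 := ConcreteCategory.congr_hom (α.naturality q) x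
  refine h1.trans ?_
  rw [Functor.map_comp]
  exact congrArg (G.map q) hx

theorem imageSieve_mem_of_surjective (hX : IsUnit (N : Γ(X, ⊤))) (α : F ⟶ G)
    (h : ∀ R : CommRingCat.{u}, IsUnit (N : R) → ∀ y : G.obj R,
      EtaleLocally R fun R' f => ∃ x, α.app R' x = G.map f y)
    (s : (assocSheaf.obj G).obj.obj (op X)) :
    Presheaf.imageSieve (assocSheaf.map α).hom s ∈ Scheme.etaleTopology.{u} X := by
  refine mem_of_sec s _ fun {Y} g y hy => ?_
  have hloc := h Γ(Y, ⊤) (isUnit_natCast_of_hom g.appTop hX) y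
  refine Scheme.etaleTopology.{u}.superset_covering ?_ hloc.ringSieve_mem
  rintro Z' l ⟨R', f, q, hfq, x, hx⟩
  refine ⟨sec F Z' (F.map q x), ?_⟩
  rw [sec_map, restrict_comp, ← hy, sec_restrict, ← hfq]
  congr 1
  have h1 := ConcreteCategory.congr_hom (α.naturality q) x
  refine h1.trans ?_
  rw [Functor.map_comp]
  exact congrArg (G.map q) hx

theorem equalizerSieve_mem_of_injective (hX : IsUnit (N : Γ(X, ⊤))) (α : F ⟶ G)
    (h : ∀ R : CommRingCat.{u}, IsUnit (N : R) → ∀ x : F.obj R, α.app R x = 0 →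
      EtaleLocally R fun _ f => F.map f x = 0)
    (s : (assocSheaf.obj F).obj.obj (op X)) (hs : (assocSheaf.map α).hom.app (op X) s = 0) :
    Presheaf.equalizerSieve s 0 ∈ Scheme.etaleTopology.{u} X := by
  refine mem_of_sec s _ fun {Y} g y hy => ?_
  have h0 : sec G Y (α.app _ y) = 0 := by
    rw [← sec_map, hy, restrict_map, hs, map_zero]
  obtain ⟨T, hT, hT0⟩ := exists_restrict_eq_zero _ h0
  refine Scheme.etaleTopology.{u}.transitive hT _ fun Z k hk => ?_
  have hloc := h Γ(Z, ⊤) (isUnit_natCast_of_hom (k ≫ g).appTop hX) (F.map k.appTop y)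
    ((ConcreteCategory.congr_hom (α.naturality k.appTop) y).trans (hT0 k hk))
  refine Scheme.etaleTopology.{u}.superset_covering ?_ hloc.ringSieve_mem
  rintro Z' l ⟨R', f, q, hfq, hx⟩
  change (assocSheaf.obj F).obj.map (l ≫ k ≫ g).op s = (assocSheaf.obj F).obj.map _ 0
  rw [map_zero, restrict_comp, restrict_comp, ← hy, sec_restrict, sec_restrict, ← hfq,
    Functor.map_comp]
  exact (congrArg _ ((congrArg (F.map q) hx).trans (map_zero _))).trans (map_zero _)

variable {S : Scheme.{u}}

instance assocSheaf_additive : assocSheaf.{u}.Additive where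
  map_add {F G α β} := by
    have h : Functor.whiskerLeft Scheme.Γ (Functor.whiskerRight (α + β)
          AddCommGrpCat.uliftFunctor.{u + 1, u}) =
        Functor.whiskerLeft Scheme.Γ (Functor.whiskerRight α AddCommGrpCat.uliftFunctor) +
          Functor.whiskerLeft Scheme.Γ (Functor.whiskerRight β AddCommGrpCat.uliftFunctor) := by
      ext X x
      rfl
    exact (congrArg (presheafToSheaf Scheme.etaleTopology.{u} AddCommGrpCat.{u + 1}).map h).trans
      (Functor.map_add _)

instance (S : Scheme.{u}) : (restrictTo S).Additive where
  map_add := by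
    intros
    ext X x
    rfl

instance {S S' : Scheme.{u}} (f : S' ⟶ S) : (baseChange f).Additive where
  map_add := by
    intros
    ext X x
    rfl

theorem shMap_comp (S : Scheme.{u}) (α : F ⟶ G) (β : G ⟶ H) :
    shMap S (α ≫ β) = shMap S α ≫ shMap S β := by
  simp only [shMap, Functor.map_comp]

theorem shMap_add (S : Scheme.{u}) (α β : F ⟶ G) :
    shMap S (α + β) = shMap S α + shMap S β := by
  simp only [shMap, Functor.map_add]

theorem shMap_nsmul (S : Scheme.{u}) (n : ℕ) (α : F ⟶ G) :
    shMap S (n • α) = n • shMap S α := by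
  simp only [shMap, Functor.map_nsmul]

theorem shMap_zero (S : Scheme.{u}) : shMap S (0 : F ⟶ G) = 0 := by
  simp only [shMap, Functor.map_zero]

theorem shMap_comp_eq_zero (S : Scheme.{u}) (α : F ⟶ G) (β : G ⟶ H) (w : α ≫ β = 0) :
    shMap S α ≫ shMap S β = 0 := by
  rw [← shMap_comp, w, shMap_zero]

theorem epi_shMap (hS : IsUnit (N : Γ(S, ⊤))) (α : F ⟶ G)
    (h : ∀ R : CommRingCat.{u}, IsUnit (N : R) → ∀ y : G.obj R,
      EtaleLocally R fun R' f => ∃ x, α.app R' x = G.map f y) : Epi (shMap S α) := by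
  rw [← Sheaf.isLocallySurjective_iff_epi']
  refine ⟨fun {Y} s => ?_⟩
  rw [GrothendieckTopology.mem_over_iff]
  refine Scheme.etaleTopology.{u}.superset_covering ?_
    (imageSieve_mem_of_surjective (isUnit_natCast_of_hom Y.hom.appTop hS) α h s)
  rintro Z g ⟨t, ht⟩
  rw [Sieve.overEquiv_iff]
  exact ⟨t, ht⟩

theorem mono_shMap (hS : IsUnit (N : Γ(S, ⊤))) (α : F ⟶ G)
    (h : ∀ R : CommRingCat.{u}, IsUnit (N : R) → ∀ x : F.obj R, α.app R x = 0 →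
      EtaleLocally R fun _ f => F.map f x = 0) : Mono (shMap S α) := by
  have : Sheaf.IsLocallyInjective (shMap S α) := ⟨fun {Y} s t hst => by
    rw [GrothendieckTopology.mem_over_iff]
    refine Scheme.etaleTopology.{u}.superset_covering ?_
      (equalizerSieve_mem_of_injective (isUnit_natCast_of_hom Y.unop.hom.appTop hS) α h
        (s - t) ((map_sub _ _ _).trans (sub_eq_zero.2 hst)))
    intro Z g hg
    rw [Sieve.overEquiv_iff]
    exact sub_eq_zero.1 ((map_sub _ _ _).symm.trans (hg.trans (map_zero _)))⟩
  exact Sheaf.mono_of_isLocallyInjective _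

theorem exact_shMap (hS : IsUnit (N : Γ(S, ⊤))) (α : F ⟶ G) (β : G ⟶ H)
    (w : shMap S α ≫ shMap S β = 0)
    (h : ∀ R : CommRingCat.{u}, IsUnit (N : R) → ∀ y : G.obj R, β.app R y = 0 →
      EtaleLocally R fun R' f => ∃ x, α.app R' x = G.map f y) :
    (ShortComplex.mk (shMap S α) (shMap S β) w).Exact := by
  rw [ShortComplex.exact_iff_epi_kernel_lift, ← Sheaf.isLocallySurjective_iff_epi']
  refine ⟨fun {Y} s => ?_⟩
  rw [GrothendieckTopology.mem_over_iff]
  -- A section of the kernel lifts locally as a section of `G`, which suffices since the inclusion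
  -- of the kernel is injective on sections.
  let ι := Limits.kernel.ι (shMap S β)
  have hι (Z : Over S) : Function.Injective (ι.hom.app (op Z)) := by
    have : Mono ι.hom := inferInstanceAs (Mono ((sheafToPresheaf _ _).map ι))
    exact (AddCommGrpCat.mono_iff_injective _).1 inferInstance
  have hs : (assocSheaf.map β).hom.app (op Y.left) (ι.hom.app (op Y) s) = 0 :=
    ConcreteCategory.congr_hom (congr_app (congrArg (fun k => k.hom)
      (Limits.kernel.condition (shMap S β))) (op Y)) s
  refine Scheme.etaleTopology.{u}.superset_covering ?_
    (imageSieve_mem_of_exact (isUnit_natCast_of_hom Y.hom.appTop hS) α β h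
      (ι.hom.app (op Y) s) hs)
  rintro Z g ⟨t, ht⟩
  rw [Sieve.overEquiv_iff]
  refine ⟨t, hι _ ?_⟩
  have h₁ := ConcreteCategory.congr_hom (congr_app (congrArg (fun k => k.hom)
    (Limits.kernel.lift_ι (shMap S β) (shMap S α) w)) (op (Over.mk (g ≫ Y.hom)))) t
  have h₂ := ConcreteCategory.congr_hom (ι.hom.naturality
    (Over.homMk g : Over.mk (g ≫ Y.hom) ⟶ Y).op) s
  exact h₁.trans (ht.trans h₂.symm)

theorem isShortExact_shMap (hS : IsUnit (N : Γ(S, ⊤))) (α : F ⟶ G) (β : G ⟶ H)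
    (w : α ≫ β = 0)
    (hα : ∀ R : CommRingCat.{u}, IsUnit (N : R) → ∀ x : F.obj R, α.app R x = 0 →
      EtaleLocally R fun _ f => F.map f x = 0)
    (hαβ : ∀ R : CommRingCat.{u}, IsUnit (N : R) → ∀ y : G.obj R, β.app R y = 0 →
      EtaleLocally R fun R' f => ∃ x, α.app R' x = G.map f y)
    (hβ : ∀ R : CommRingCat.{u}, IsUnit (N : R) → ∀ z : H.obj R,
      EtaleLocally R fun R' f => ∃ y, β.app R' y = H.map f z) :
    IsShortExact (shMap S α) (shMap S β) := by
  have w' := shMap_comp_eq_zero S α β w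
  exact ⟨w', { exact := exact_shMap hS α β w' hαβ
               mono_f := mono_shMap hS α hα
               epi_g := epi_shMap hS β hβ }⟩

instance (S : Scheme.{u}) : EnoughInjectives (EtSheafOver S) := by
  have : EssentiallySmall.{u + 1} (Over S) := inferInstance
  have : IsGrothendieckAbelian.{u + 1} (EtSheafOver S) :=
    Sheaf.isGrothendieckAbelian_of_essentiallySmall.{u + 1}
      (Scheme.etaleTopology.{u}.over S) AddCommGrpCat.{u + 1}
  infer_instance

section BaseChange

variable {S' : Scheme.{u}} (f : S' ⟶ S) {Z Z' : EtSheafOver S}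

theorem bcHom_sub (m m' : shOver S F ⟶ Z) : bcHom f (m - m') = bcHom f m - bcHom f m' := by
  rw [bcHom, Functor.map_sub, Preadditive.comp_sub]
  rfl

theorem bcHom_nsmul (n : ℕ) (m : shOver S F ⟶ Z) : bcHom f (n • m) = n • bcHom f m := by
  rw [bcHom, Functor.map_nsmul, Preadditive.comp_nsmul]
  rfl

theorem bcHom_comp (m : shOver S F ⟶ Z) (g : Z ⟶ Z') :
    bcHom f (m ≫ g) = bcHom f m ≫ (baseChange f).map g := by
  simp only [bcHom, Functor.map_comp, Category.assoc]

theorem bcHom_shMap_comp (α : F ⟶ G) (m : shOver S G ⟶ Z) :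
    bcHom f (shMap S α ≫ m) = shMap S' α ≫ bcHom f m := by
  have h : ((assocSheaf.obj F).pushforwardOverMapIso f).inv ≫
        (baseChange f).map ((restrictTo S).map (assocSheaf.map α)) =
      (restrictTo S').map (assocSheaf.map α) ≫
        ((assocSheaf.obj G).pushforwardOverMapIso f).inv := by
    ext X x
    rfl
  rw [bcHom, Functor.map_comp, ← Category.assoc, h, Category.assoc]
  rfl

end BaseChange

end

/-! ### Roots of unity étale-locally -/

noncomputable section

open Polynomial

/-- A root of a monic polynomial exists étale-locally when it has a simple root in every
algebraically closed field. -/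
theorem etaleLocally_exists_root {R : CommRingCat.{u}} {f : R[X]} (hf : f.Monic)
    (h : ∀ (K : Type u) [Field K] [IsAlgClosed K] (φ : R →+* K),
      ∃ x : K, eval₂ φ x f = 0 ∧ eval₂ φ x (derivative f) ≠ 0) :
    EtaleLocally R fun R' g => ∃ x : R', eval₂ g.hom x f = 0 := by
  intro p
  -- The standard étale algebra on which `f` has a root and `f'` is invertible there. A simple root
  -- in an algebraic closure of the residue field at `p` is a point of it over `p`.
  let K := AlgebraicClosure p.asIdeal.ResidueField
  obtain ⟨x, hx, hx'⟩ := h K (algebraMap R K)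
  let P : StandardEtalePair R := ⟨f, hf, derivative f, 1, 0, 1, by simp⟩
  have hP : P.HasMap x := ⟨hx, isUnit_iff_ne_zero.2 hx'⟩
  refine ⟨CommRingCat.of P.Ring, CommRingCat.ofHom (algebraMap R P.Ring),
    RingHom.etale_algebraMap.2 inferInstance,
    ⟨PrimeSpectrum.comap (P.lift x hP).toRingHom ⊥, ?_⟩, P.X, P.hasMap_X.1⟩
  ext r
  have h1 : (P.lift x hP) (algebraMap R P.Ring r) = algebraMap R K r := (P.lift x hP).commutes r
  have h2 : algebraMap R K r = 0 ↔ r ∈ p.asIdeal := by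
    rw [IsScalarTower.algebraMap_apply R p.asIdeal.ResidueField K, map_eq_zero,
      Ideal.algebraMap_residueField_eq_zero]
  rw [← h2, ← h1]
  rfl

variable {R : CommRingCat.{u}} {n : ℕ}

theorem etaleLocally_exists_pow_eq (hn : IsUnit (n : R)) (hn0 : n ≠ 0) (a : Rˣ) :
    EtaleLocally R fun R' f => ∃ x : R'ˣ, x ^ n = Units.map (f.hom : R →* R') a := by
  refine (etaleLocally_exists_root (f := X ^ n - C (a : R)) (monic_X_pow_sub_C _ hn0) ?_).mono ?_
  · intro K _ _ φ
    have hnK : (n : K) ≠ 0 := by simpa using (hn.map φ).ne_zero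
    obtain ⟨x, hx⟩ := IsAlgClosed.exists_pow_nat_eq (φ a) (Nat.pos_of_ne_zero hn0)
    have hx0 : x ≠ 0 := by
      rintro rfl
      rw [zero_pow hn0] at hx
      exact (a.isUnit.map φ).ne_zero hx.symm
    refine ⟨x, by simp [hx], ?_⟩
    simp [derivative_X_pow, eval₂_mul, eval₂_pow, hnK, hx0]
  · rintro R' g ⟨x, hx⟩
    have hx' : x ^ n = g.hom (a : R) := by simpa [sub_eq_zero] using hx
    have hu : IsUnit x := (isUnit_pow_iff hn0).1 (hx' ▸ a.isUnit.map g.hom)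
    exact ⟨hu.unit, Units.ext (by simpa using hx')⟩

theorem etaleLocally_exists_isRoot_cyclotomic (hn : IsUnit (n : R)) (hn0 : n ≠ 0) :
    EtaleLocally R fun R' _ => ∃ b : R'ˣ, (cyclotomic n R').IsRoot b := by
  refine (etaleLocally_exists_root (cyclotomic.monic n R) ?_).mono ?_
  · intro K _ _ φ
    have hnK : (n : K) ≠ 0 := by simpa using (hn.map φ).ne_zero
    have : NeZero (n : K) := ⟨hnK⟩
    obtain ⟨x, hx⟩ := IsAlgClosed.exists_root (cyclotomic n K)
      (degree_cyclotomic_pos n K (Nat.pos_of_ne_zero hn0)).ne'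
    have hx0 : eval₂ φ x (cyclotomic n R) = 0 := by
      rw [eval₂_eq_eval_map, map_cyclotomic]; exact hx
    refine ⟨x, hx0, ?_⟩
    have hsep : (cyclotomic n R |>.map φ).Separable := by
      rw [map_cyclotomic]; exact separable_cyclotomic n K
    rw [eval₂_eq_eval_map, ← derivative_map, ← eval₂_id]
    refine hsep.eval₂_derivative_ne_zero _ ?_
    rw [eval₂_id, ← eval₂_eq_eval_map, hx0]
  · rintro R' g ⟨x, hx⟩
    have hx' : (cyclotomic n R').IsRoot x := by
      rwa [eval₂_eq_eval_map, map_cyclotomic] at hx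
    have hpow : x ^ n = 1 := by
      have := (hx'.dvd (cyclotomic.dvd_X_pow_sub_one n R'))
      simpa [IsRoot, sub_eq_zero] using this
    exact ⟨Units.ofPowEqOne x n hpow hn0, hx'⟩

theorem isPrimitiveRoot_of_isRoot_cyclotomic {A K : Type*} [CommRing A] [Field K] (φ : A →+* K)
    (hn : IsUnit (n : A)) {b : A} (hb : (cyclotomic n A).IsRoot b) :
    IsPrimitiveRoot (φ b) n := by
  have hnK : (n : K) ≠ 0 := by simpa using (hn.map φ).ne_zero
  have : NeZero (n : K) := ⟨hnK⟩
  rw [← isRoot_cyclotomic_iff, ← map_cyclotomic n φ]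
  exact hb.map

theorem pow_eq_one_of_isRoot_cyclotomic {A : Type*} [CommRing A] {b : Aˣ}
    (hb : (cyclotomic n A).IsRoot b) : b ^ n = 1 := by
  have := (hb.dvd (cyclotomic.dvd_X_pow_sub_one n A))
  exact Units.ext (by simpa [IsRoot, sub_eq_zero] using this)

theorem pow_eq_neg_one_of_isRoot_cyclotomic {A : Type*} [CommRing A] {m : ℕ} (hm : 0 < m)
    {b : Aˣ} (hb : (cyclotomic (2 * m) A).IsRoot b) : b ^ m = -1 := by
  have h1 := X_pow_sub_one_mul_cyclotomic_dvd_X_pow_sub_one_of_dvd A (d := m) (n := 2 * m)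
    (Nat.mem_properDivisors.2 ⟨dvd_mul_left _ _, by omega⟩)
  have h2 : (X ^ (2 * m) - 1 : A[X]) = (X ^ m - 1) * (X ^ m + 1) := by ring
  have h3 : cyclotomic (2 * m) A ∣ X ^ m + 1 := by
    obtain ⟨q, hq⟩ := h1
    refine ⟨q, (monic_X_pow_sub_C (1 : A) hm.ne').isRegular.left ?_⟩
    simp only [map_one]
    rw [← h2, hq, mul_assoc]
  have h4 := hb.dvd h3
  refine Units.ext ?_
  simpa [IsRoot, add_eq_zero_iff_eq_neg] using h4

theorem dvd_of_zpow_eq_one {A : Type*} [CommRing A] [Nontrivial A] (hn : IsUnit (n : A)) {b : Aˣ}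
    (hb : (cyclotomic n A).IsRoot b) {k : ℤ} (hk : b ^ k = 1) : (n : ℤ) ∣ k := by
  obtain ⟨M, hM⟩ := Ideal.exists_maximal A
  let := Ideal.Quotient.field M
  have h := isPrimitiveRoot_of_isRoot_cyclotomic (Ideal.Quotient.mk M) hn hb
  rw [← h.zpow_eq_one_iff_dvd]
  have := congrArg (fun u : (A ⧸ M)ˣ => (u : A ⧸ M))
    (congrArg (Units.map (Ideal.Quotient.mk M : A →* A ⧸ M)) hk)
  simpa using this

/-- Étale-locally, and even Zariski-locally, an `n`-th root of unity is a power of a given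
primitive one: two `n`-th roots of unity which agree at a point agree in a neighbourhood. -/
theorem etaleLocally_exists_eq_pow (hn : IsUnit (n : R)) (hn0 : n ≠ 0) {a b : Rˣ}
    (hb : (cyclotomic n R).IsRoot b) (ha : a ^ n = 1) :
    EtaleLocally R fun R' f => ∃ k : ℕ,
      Units.map (f.hom : R →* R') a = Units.map (f.hom : R →* R') b ^ k := by
  intro p
  let φ := algebraMap R p.asIdeal.ResidueField
  have hφ (r : R) : φ r = 0 ↔ r ∈ p.asIdeal := Ideal.algebraMap_residueField_eq_zero
  have : NeZero n := ⟨hn0⟩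
  obtain ⟨k, -, hk⟩ := (isPrimitiveRoot_of_isRoot_cyclotomic φ hn hb).eq_pow_of_pow_eq_one
    (ξ := φ a) (by rw [← map_pow, ← Units.val_pow_eq_pow_val, ha, Units.val_one, map_one])
  let c : Rˣ := a * (b ^ k)⁻¹
  have hcφ : φ c = 1 := by
    have h1 : (c : R) * (b : R) ^ k = a := by
      rw [← Units.val_pow_eq_pow_val, ← Units.val_mul]; simp [c]
    have h2 : φ c * φ b ^ k = φ b ^ k := by rw [← map_pow, ← map_mul, h1, map_pow, hk]
    exact mul_right_cancel₀ (pow_ne_zero k (b.isUnit.map φ).ne_zero) (h2.trans (one_mul _).symm)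
  have hcn : (c : R) ^ n = 1 := by
    rw [← Units.val_pow_eq_pow_val, mul_pow, ha, inv_pow, ← pow_mul, mul_comm k, pow_mul,
      pow_eq_one_of_isRoot_cyclotomic hb]
    simp
  -- `c ^ n = 1` and `c = 1` at `p`, so `1 + c + ⋯ + c ^ (n - 1)` is invertible near `p`, and it
  -- kills `c - 1`.
  let s : R := ∑ i ∈ Finset.range n, (c : R) ^ i
  have hs : s ∉ p.asIdeal := by
    rw [← hφ]
    simpa [s, hcφ] using (hn.map φ).ne_zero
  have hsc : s * ((c : R) - 1) = 0 := by rw [geom_sum_mul, hcn, sub_self]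
  let R' := CommRingCat.of (Localization.Away s)
  let f : R ⟶ R' := CommRingCat.ofHom (algebraMap R (Localization.Away s))
  refine ⟨R', f, RingHom.etale_algebraMap.2 (Algebra.Etale.of_isLocalizationAway s), ?_, k, ?_⟩
  · have : p ∈ Set.range (PrimeSpectrum.comap (algebraMap R (Localization.Away s))) := by
      rw [PrimeSpectrum.localization_away_comap_range _ s]
      exact hs
    exact this
  · have hu : IsUnit (f.hom s) := IsLocalization.Away.algebraMap_isUnit s
    have h1 : f.hom (c : R) = 1 := by
      have := congrArg f.hom hsc
      rw [map_mul, map_zero, hu.mul_right_eq_zero, map_sub, map_one, sub_eq_zero] at this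
      exact this
    have h2 : Units.map (f.hom : R →* R') c = 1 := Units.ext h1
    rwa [map_mul, map_inv, mul_inv_eq_one, map_pow] at h2

end

/-! ### The three exact sequences and the symmetrization -/

noncomputable section

variable {N : ℕ}

theorem kummer_exact (hN : 1 ≤ N) {S : Scheme.{u}} (hS : IsUnit (N : Γ(S, ⊤))) :
    IsShortExact (kumI N S) (kumP N S) := by
  refine isShortExact_shMap hS _ _ ?_ (fun R _ x hx => ?_) (fun R _ y hy => ?_)
    (fun R hR z => ?_)
  · ext R x
    exact x.2
  · exact .of_id ((congrArg _ (Subtype.ext hx)).trans (map_zero _))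
  · refine .of_id ⟨⟨y, hy⟩, ?_⟩
    rw [CategoryTheory.Functor.map_id]
    rfl
  · refine (etaleLocally_exists_pow_eq hR (by omega) (Additive.toMul z)).mono ?_
    rintro R' f ⟨x, hx⟩
    exact ⟨Additive.ofMul x, hx⟩

theorem heisenberg_exact {S : Scheme.{u}} (hS : IsUnit (N : Γ(S, ⊤))) :
    IsShortExact (heiI N S) (heiP N S) := by
  refine isShortExact_shMap hS _ _ ?_ (fun R _ x hx => ?_) (fun R _ y hy => ?_)
    (fun R hR z => ?_)
  · ext R x
    rfl
  · exact .of_id ((congrArg _ (congrArg Heis.z hx)).trans (map_zero _))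
  · refine .of_id ⟨y.z, ?_⟩
    rw [CategoryTheory.Functor.map_id]
    exact Heis.ext rfl hy.symm
  · refine .of_id ⟨(⟨0, z⟩ : Heis (rootsSub N R)), ?_⟩
    rw [CategoryTheory.Functor.map_id]
    rfl

section Yoneda

variable {R : Type u} [CommRing R]

/-- An `N`-th root of `-1` splits the extension of `ℤ` by `μ_N`. -/
def etaSplit (e : etaSub N R) (he : e.1.2 = 1) : etaSub N R →+ rootsSub N R where
  toFun x := ⟨x.1.1 - x.1.2 • e.1.1, by
    change N • (x.1.1 - x.1.2 • e.1.1) = 0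
    rw [nsmul_sub, show N • x.1.1 = _ from x.2, ← natCast_zsmul, zsmul_comm, natCast_zsmul,
      show N • e.1.1 = _ from e.2, he, one_zsmul, sub_self]⟩
  map_zero' := Subtype.ext (by simp)
  map_add' x y := Subtype.ext (by
    change x.1.1 + y.1.1 - (x.1.2 + y.1.2) • e.1.1 = x.1.1 - _ + (y.1.1 - _)
    rw [add_zsmul]; abel)

theorem etaSplit_etaIncl (e : etaSub N R) (he : e.1.2 = 1) (a : rootsSub N R) :
    etaSplit e he (etaIncl N R a) = a :=
  Subtype.ext (by
    change a.1 - (0 : ℤ) • e.1.1 = a.1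
    rw [zero_zsmul, sub_zero])

theorem etaIncl_etaSplit (e : etaSub N R) (he : e.1.2 = 1) (x : etaSub N R) :
    etaIncl N R (etaSplit e he x) + x.1.2 • e = x := by
  refine Subtype.ext (Prod.ext ?_ ?_)
  · change x.1.1 - x.1.2 • e.1.1 + x.1.2 • e.1.1 = x.1.1
    abel
  · change 0 + x.1.2 • e.1.2 = x.1.2
    rw [he, smul_eq_mul, mul_one, zero_add]

/-- The splitting of the extension of `μ_N` by `μ_N ⊗ μ_N` given by an `N`-th root of `-1`. -/
def yonSplit (e : etaSub N R) (he : e.1.2 = 1) :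
    YonGrp N R →+ rootsSub N R ⊗[ℤ] rootsSub N R :=
  ((etaSplit e he).toIntLinearMap.lTensor (rootsSub N R)).toAddMonoidHom

theorem yonSplit_yonIncl (e : etaSub N R) (he : e.1.2 = 1)
    (t : rootsSub N R ⊗[ℤ] rootsSub N R) : yonSplit e he (yonIncl N R t) = t := by
  have : (yonSplit e he).comp (yonIncl N R) = AddMonoidHom.id _ :=
    tensor_hom_ext fun a b => congrArg (a ⊗ₜ[ℤ] ·) (etaSplit_etaIncl e he b)
  exact DFunLike.congr_fun this t

theorem yonIncl_yonSplit (e : etaSub N R) (he : e.1.2 = 1) (y : YonGrp N R) :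
    yonIncl N R (yonSplit e he y) + yonProj N R y ⊗ₜ[ℤ] e = y := by
  have : (yonIncl N R).comp (yonSplit e he) +
      ((TensorProduct.mk ℤ _ _).flip e).toAddMonoidHom.comp (yonProj N R) =
        AddMonoidHom.id _ := by
    refine tensor_hom_ext fun a x => ?_
    change a ⊗ₜ[ℤ] etaIncl N R (etaSplit e he x) + (x.1.2 • a) ⊗ₜ[ℤ] e = a ⊗ₜ[ℤ] x
    rw [TensorProduct.smul_tmul, ← TensorProduct.tmul_add, etaIncl_etaSplit]
  exact DFunLike.congr_fun this y

end Yoneda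

theorem etaleLocally_exists_eta (hN : 1 ≤ N) {R : CommRingCat.{u}} (hR : IsUnit (N : R)) :
    EtaleLocally R fun R' _ => ∃ e : etaSub N R', e.1.2 = 1 := by
  refine (etaleLocally_exists_pow_eq hR (by omega) (-1)).mono ?_
  rintro R' f ⟨x, hx⟩
  refine ⟨⟨(Additive.ofMul x, 1), ?_⟩, rfl⟩
  change N • Additive.ofMul x = (1 : ℤ) • Additive.ofMul (-1 : R'ˣ)
  rw [one_zsmul, ← ofMul_pow, hx]
  congr 1
  ext
  simp

theorem yoneda_exact (hN : 1 ≤ N) {S : Scheme.{u}} (hS : IsUnit (N : Γ(S, ⊤))) :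
    IsShortExact (yonI N S) (yonP N S) := by
  refine isShortExact_shMap hS _ _ ?_ (fun R hR x hx => ?_) (fun R hR y hy => ?_)
    (fun R hR z => ?_)
  · ext R : 2
    refine ConcreteCategory.hom_ext _ _ fun t => ?_
    have : (yonProj N R).comp (yonIncl N R) = 0 :=
      tensor_hom_ext fun a b => zero_zsmul a
    exact DFunLike.congr_fun this t
  · refine (etaleLocally_exists_eta hN hR).mono ?_
    rintro R' f ⟨e, he⟩
    have h1 : yonIncl N R' ((muFun N ⋙ tensorSqFun).map f x) = 0 :=
      (ConcreteCategory.congr_hom ((yonInclNat N).naturality f) x).trans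
        ((congrArg _ hx).trans (map_zero _))
    have h2 := yonSplit_yonIncl e he ((muFun N ⋙ tensorSqFun).map f x)
    rw [h1, map_zero] at h2
    exact h2.symm
  · refine (etaleLocally_exists_eta hN hR).mono ?_
    rintro R' f ⟨e, he⟩
    have h1 : yonProj N R' ((yonFun N).map f y) = 0 :=
      (ConcreteCategory.congr_hom ((yonProjNat N).naturality f) y).trans
        ((congrArg ((muFun N).map f) hy).trans (map_zero _))
    have h2 := yonIncl_yonSplit e he ((yonFun N).map f y)
    rw [h1, TensorProduct.zero_tmul, add_zero] at h2
    exact ⟨_, h2⟩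
  · refine (etaleLocally_exists_eta hN hR).mono ?_
    rintro R' f ⟨e, he⟩
    refine ⟨((muFun N).map f z : rootsSub N R') ⊗ₜ[ℤ] e, ?_⟩
    change e.1.2 • (muFun N).map f z = _
    rw [he, one_zsmul]

section Symmetric

/-- A relation `a ⊗ b = b ⊗ a` between roots of unity holds étale-locally: there `a` and `b` are
powers of one root of unity. -/
theorem etaleLocally_tmul_comm (hN : 1 ≤ N) {R : CommRingCat.{u}} (hR : IsUnit (N : R))
    (a b : rootsSub N R) :
    EtaleLocally R fun _ f =>
      rootsMap N f.hom a ⊗ₜ[ℤ] rootsMap N f.hom b =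
        rootsMap N f.hom b ⊗ₜ[ℤ] rootsMap N f.hom a := by
  have hN0 : N ≠ 0 := by omega
  have hpow {A : Type u} [CommRing A] (x : rootsSub N A) : Additive.toMul x.1 ^ N = 1 := x.2
  refine (etaleLocally_exists_isRoot_cyclotomic hR hN0).bind ?_
  rintro R₁ f₁ ⟨z, hz⟩
  have hR₁ := isUnit_natCast_of_hom f₁ hR
  refine (etaleLocally_exists_eq_pow hR₁ hN0 hz (hpow (rootsMap N f₁.hom a))).bind ?_
  rintro R₂ f₂ ⟨k, hk⟩
  have hR₂ := isUnit_natCast_of_hom f₂ hR₁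
  have hz₂ : (Polynomial.cyclotomic N R₂).IsRoot (Units.map (f₂.hom : R₁ →* R₂) z) := by
    rw [← Polynomial.map_cyclotomic N f₂.hom]
    exact hz.map
  refine (etaleLocally_exists_eq_pow hR₂ hN0 hz₂
    (hpow (rootsMap N f₂.hom (rootsMap N f₁.hom b)))).mono ?_
  rintro R₃ f₃ ⟨l, hl⟩
  let ζ : rootsSub N R₃ := rootsMap N f₃.hom ⟨Additive.ofMul (Units.map (f₂.hom : R₁ →* R₂) z),
    congrArg Additive.ofMul (pow_eq_one_of_isRoot_cyclotomic hz₂)⟩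
  have ha : rootsMap N (f₁ ≫ f₂ ≫ f₃).hom a = k • ζ :=
    Subtype.ext ((congrArg (unitsMap f₃.hom) (congrArg Additive.ofMul hk)).trans
      (map_nsmul (unitsMap f₃.hom) k (Additive.ofMul (Units.map (f₂.hom : R₁ →* R₂) z))))
  have hb : rootsMap N (f₁ ≫ f₂ ≫ f₃).hom b = l • ζ := Subtype.ext (congrArg Additive.ofMul hl)
  rw [ha, hb]
  simp only [← natCast_zsmul, TensorProduct.smul_tmul', TensorProduct.tmul_smul]
  rw [smul_comm]

theorem etaleLocally_eq_zero_of_mem_symRel (hN : 1 ≤ N) {R : CommRingCat.{u}}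
    (hR : IsUnit (N : R)) {t : rootsSub N R ⊗[ℤ] rootsSub N R} (ht : t ∈ symRel (rootsSub N R)) :
    EtaleLocally R fun _ f => tensorSqMap (rootsMap N f.hom) t = 0 := by
  -- The statement for all base changes of `t` is stable under sums.
  suffices ∀ (R₁ : CommRingCat.{u}) (g : R ⟶ R₁),
      EtaleLocally R₁ fun _ f => tensorSqMap (rootsMap N (g ≫ f).hom) t = 0 by
    simpa only [Category.id_comp] using this R (𝟙 R)
  induction ht using Submodule.span_induction with
  | mem x hx =>
    obtain ⟨a, b, rfl⟩ := hx
    intro R₁ g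
    refine (etaleLocally_tmul_comm hN (isUnit_natCast_of_hom g hR) (rootsMap N g.hom a)
      (rootsMap N g.hom b)).mono fun R' f h => ?_
    rw [map_sub, sub_eq_zero]
    exact h
  | zero => exact fun R₁ g => .of_id (map_zero _)
  | add x y _ _ hx hy =>
    intro R₁ g
    refine (hx R₁ g).bind fun R₂ f₂ h₂ => ?_
    refine (hy R₂ (g ≫ f₂)).mono fun R₃ f₃ h₃ => ?_
    rw [map_add]
    have h₄ : tensorSqMap (rootsMap N ((g ≫ f₂) ≫ f₃).hom) x = 0 :=
      (ConcreteCategory.congr_hom ((muFun N ⋙ tensorSqFun).map_comp (g ≫ f₂) f₃) x).trans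
        ((congrArg ((muFun N ⋙ tensorSqFun).map f₃) h₂).trans (map_zero _))
    rw [Category.assoc] at h₃ h₄
    rw [h₃, h₄, add_zero]
  | smul n x _ hx =>
    intro R₁ g
    refine (hx R₁ g).mono fun R₂ f₂ h₂ => ?_
    rw [map_zsmul, h₂, smul_zero]

theorem isIso_symS (hN : 1 ≤ N) {S : Scheme.{u}} (hS : IsUnit (N : Γ(S, ⊤))) :
    IsIso (symS N S) := by
  have : Mono (symS N S) := mono_shMap hS _ fun R hR x hx =>
    etaleLocally_eq_zero_of_mem_symRel hN hR ((Submodule.Quotient.mk_eq_zero _).1 hx)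
  have : Epi (symS N S) := epi_shMap hS _ fun R _ y => by
    obtain ⟨x, hx⟩ := Submodule.mkQ_surjective (symRel (rootsSub N R)) y
    refine .of_id ⟨x, hx.trans ?_⟩
    rw [CategoryTheory.Functor.map_id]
    rfl
  exact isIso_of_mono_of_epi _

end Symmetric

end

/-! ### Special `N²`-th roots of unity -/

noncomputable section

theorem two_mul_choose_two_add (n : ℕ) : 2 * n.choose 2 + n = n * n := by
  induction n with
  | zero => rfl
  | succ n ih =>
    rw [Nat.choose_succ_succ' n 1, Nat.choose_one_right]
    linarith

theorem symProd_nsmul_left {A : Type u} [AddCommGroup A] (n : ℕ) (a b : A) :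
    symProd (n • a) b = n • symProd a b := by
  rw [symProd, symProd, ← map_nsmul, TensorProduct.smul_tmul']

theorem nsmul_heis {A : Type u} [AddCommGroup A] (k : ℕ) (a : A) :
    k • (⟨0, a⟩ : Heis A) = ⟨k.choose 2 • symProd a a, k • a⟩ := by
  induction k with
  | zero => rw [zero_nsmul]; exact Heis.ext (zero_nsmul _).symm (zero_nsmul a).symm
  | succ k ih =>
    rw [succ_nsmul, ih]
    refine Heis.ext ?_ (succ_nsmul a k).symm
    rw [Heis.add_z, Nat.choose_succ_succ' k 1, Nat.choose_one_right, symProd_nsmul_left, add_zero,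
      add_nsmul, add_comm]

variable (N : ℕ)

section Rings

variable (R : Type u) [CommRing R]

theorem nsmul_rootsSub (a : rootsSub N R) : N • a = 0 := Subtype.ext a.2

/-- The homomorphism `a ↦ (N choose 2) a · a` from `μ_N` to `Sym²(μ_N)`. It measures the failure of
the Heisenberg extension to be killed by `N`. -/
def halfSq : rootsSub N R →+ SymSq (rootsSub N R) where
  toFun a := N.choose 2 • symProd a a
  map_zero' := by rw [symProd_zero_left, nsmul_zero]
  map_add' a b := by
    have h : N.choose 2 • (symProd a b + symProd a b) = 0 := by
      have h1 : N • symProd a b = 0 := by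
        rw [← symProd_nsmul_left, nsmul_rootsSub, symProd_zero_left]
      have h2 := congrArg (· • symProd a b) (two_mul_choose_two_add N)
      simp only [add_nsmul, mul_nsmul, h1, nsmul_zero, add_zero, two_nsmul] at h2
      exact h2
    rw [symProd_add_left, symProd_add_right, symProd_add_right, symProd_comm b a]
    calc _ = N.choose 2 • symProd a a + N.choose 2 • symProd b b +
        N.choose 2 • (symProd a b + symProd a b) := by simp only [nsmul_add]; abel
      _ = _ := by rw [h, add_zero]

theorem two_nsmul_halfSq (a : rootsSub N R) : (2 : ℕ) • halfSq N R a = 0 := by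
  have h1 : N • symProd a a = 0 := by
    rw [← symProd_nsmul_left, nsmul_rootsSub, symProd_zero_left]
  have h2 := congrArg (· • symProd a a) (two_mul_choose_two_add N)
  simp only [add_nsmul, mul_nsmul', h1, nsmul_zero, add_zero] at h2
  exact h2

/-- The unit `-1`, written additively. -/
def negOne : Additive Rˣ := Additive.ofMul (-1)

theorem two_nsmul_negOne : (2 : ℕ) • negOne R = 0 := by
  apply Additive.toMul.injective
  simp [negOne]

theorem odd_nsmul_negOne {k : ℕ} (hk : Odd k) : k • negOne R = negOne R := by
  obtain ⟨m, rfl⟩ := hk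
  rw [add_nsmul, mul_nsmul', one_nsmul, nsmul_left_comm, two_nsmul_negOne, nsmul_zero, zero_add]

theorem even_nsmul_negOne {k : ℕ} (hk : Even k) : k • negOne R = 0 := by
  obtain ⟨m, rfl⟩ := hk
  rw [← two_mul, mul_nsmul', nsmul_left_comm, two_nsmul_negOne, nsmul_zero]

/-- The `N²`-th roots of unity `b` for which `-b ^ (N choose 2)` is an `N`-th root of `-1`. They
include the primitive `N²`-th roots of unity. -/
def RootGen : Type u :=
  {b : Additive Rˣ // N • N • b = 0 ∧ N • (negOne R + N.choose 2 • b) = negOne R}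

variable {N R}

namespace RootGen

/-- The `N`-th root of unity `b ^ N`. -/
def zeta (b : RootGen N R) : rootsSub N R := ⟨N • b.1, b.2.1⟩

/-- The `N`-th root `-b ^ (N choose 2)` of `-1`. -/
def eta (b : RootGen N R) : etaSub N R :=
  ⟨(negOne R + N.choose 2 • b.1, 1), b.2.2.trans (one_zsmul _).symm⟩

/-- The `2`-torsion structure of `η` takes the value `(b ^ (N choose 2)) ^ 2 = b ^ (-N)`. -/
theorem etaRetr_eta (b : RootGen N R) : etaRetr N R b.eta = -b.zeta := by
  refine Subtype.ext ?_
  change (2 : ℕ) • (negOne R + N.choose 2 • b.1) = -(N • b.1)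
  have h := congrArg (· • b.1) (two_mul_choose_two_add N)
  simp only [add_nsmul, mul_nsmul', b.2.1] at h
  rw [nsmul_add, two_nsmul_negOne, zero_add]
  exact eq_neg_of_add_eq_zero_left h

/-- As `2 (N choose 2) = N² - N`, the `k`-th powers of the `N`-th roots of `-1` attached to `b ^ k`
and to `b` differ by the power `-(k choose 2)` of `b ^ N`. -/
theorem nsmul_eta {b b' : RootGen N R} {k : ℕ} (h : b'.1 = k • b.1) :
    k • b'.eta = k • b.eta - etaIncl N R (k.choose 2 • b.zeta) := by
  refine eq_sub_of_add_eq (Subtype.ext (Prod.ext ?_ ?_))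
  · change k • (negOne R + N.choose 2 • b'.1) + k.choose 2 • N • b.1 =
      k • (negOne R + N.choose 2 • b.1)
    have h1 : N.choose 2 * (k * k) + k.choose 2 * N =
        k * N.choose 2 + k.choose 2 * (N * N) := by
      rw [← two_mul_choose_two_add k, ← two_mul_choose_two_add N]; ring
    have h2 := congrArg (· • b.1) h1
    simp only [add_nsmul, mul_nsmul', b.2.1, nsmul_zero, add_zero] at h2
    rw [h, nsmul_add, nsmul_add, add_assoc, ← h2, nsmul_left_comm]
  · change k • (1 : ℤ) + 0 = k • (1 : ℤ)
    rw [add_zero]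

variable {R' : Type u} [CommRing R']

theorem unitsMap_negOne (f : R →+* R') : unitsMap f (negOne R) = negOne R' := unitsMap_neg_one f

/-- Functoriality of `RootGen`. -/
def map (f : R →+* R') (b : RootGen N R) : RootGen N R' :=
  ⟨unitsMap f b.1, by rw [← map_nsmul, ← map_nsmul, b.2.1, map_zero], by
    rw [← unitsMap_negOne f, ← map_nsmul, ← map_add, ← map_nsmul, b.2.2]⟩

theorem zeta_map (f : R →+* R') (b : RootGen N R) : (b.map f).zeta = rootsMap N f b.zeta :=
  Subtype.ext (map_nsmul (unitsMap f) N b.1).symm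

theorem eta_map (f : R →+* R') (b : RootGen N R) : (b.map f).eta = etaMap N f b.eta :=
  Subtype.ext (Prod.ext (by
    change negOne R' + N.choose 2 • unitsMap f b.1 = unitsMap f (negOne R + N.choose 2 • b.1)
    rw [map_add, map_nsmul, unitsMap_negOne]) rfl)

/-- A primitive `N²`-th root of unity `b`. That `-b ^ (N choose 2)` is an `N`-th root of `-1` is
clear for odd `N`, and follows from `b ^ (N² / 2) = -1` for even `N`. -/
def ofIsRoot (hN : 1 ≤ N) {b : Rˣ} (hb : (Polynomial.cyclotomic (N * N) R).IsRoot b) :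
    RootGen N R := ⟨Additive.ofMul b, by
  rw [← mul_nsmul, ← ofMul_pow, pow_eq_one_of_isRoot_cyclotomic hb, ofMul_one], by
  have hC := two_mul_choose_two_add N
  rw [nsmul_add]
  rcases Nat.even_or_odd N with h | h
  · obtain ⟨m, rfl⟩ := h
    have h1 : (2 * (m * m)) • Additive.ofMul b = negOne R := by
      rw [← ofMul_pow, pow_eq_neg_one_of_isRoot_cyclotomic (m := 2 * (m * m)) (by
        have : 0 < m := by omega
        positivity) (by convert hb using 2; ring)]
      rfl
    obtain ⟨l, rfl⟩ : ∃ l, m = l + 1 := ⟨m - 1, by omega⟩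
    have h2 : (l + 1 + (l + 1)) * (l + 1 + (l + 1)).choose 2 =
        (2 * l + 1) * (2 * ((l + 1) * (l + 1))) := by
      have h3 : (l + 1 + (l + 1)).choose 2 = (l + 1) * (2 * l + 1) := by linarith
      rw [h3]; ring
    rw [even_nsmul_negOne R ⟨l + 1, rfl⟩, zero_add, ← mul_nsmul', h2, mul_nsmul', h1,
      odd_nsmul_negOne R ⟨l, rfl⟩]
  · obtain ⟨l, rfl⟩ := h
    have h3 : (2 * l + 1).choose 2 = l * (2 * l + 1) := by linarith
    have h1 : ((2 * l + 1) * (2 * l + 1)) • Additive.ofMul b = 0 := by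
      rw [← ofMul_pow, pow_eq_one_of_isRoot_cyclotomic hb, ofMul_one]
    rw [odd_nsmul_negOne R ⟨l, rfl⟩, h3, ← mul_nsmul', mul_left_comm, mul_nsmul', h1, nsmul_zero,
      add_zero]⟩

end RootGen

end Rings

end

/-! ### A presentation of `μ_N` by roots of unity -/

noncomputable section

variable (N : ℕ)

section Rings

variable (R : Type u) [CommRing R]

/-- The free abelian group on `RootGen`. -/
abbrev GenGrp : Type u := FreeAbelianGroup (RootGen N R)

variable {N R} in
theorem genGrp_hom_ext {D : Type*} [AddCommGroup D] {g h : GenGrp N R →+ D}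
    (w : ∀ b, g (FreeAbelianGroup.of b) = h (FreeAbelianGroup.of b)) : g = h :=
  FreeAbelianGroup.lift_ext g h w

/-- The lift `b ↦ (0, b ^ N)` to the Heisenberg extension. -/
def genHeis : GenGrp N R →+ Heis (rootsSub N R) := FreeAbelianGroup.lift fun b => ⟨0, b.zeta⟩

/-- The lift `b ↦ b ^ N ⊗ (-b ^ (N choose 2))` to the extension `μ_N ⊗ E_η`. -/
def genYon : GenGrp N R →+ YonGrp N R := FreeAbelianGroup.lift fun b => b.zeta ⊗ₜ[ℤ] b.eta

/-- The lift `b ↦ b` to the Kummer sequence. -/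
def genGm : GenGrp N R →+ Additive Rˣ := FreeAbelianGroup.lift fun b => b.1

/-- The homomorphism `b ↦ b ^ N`. -/
def genMu : GenGrp N R →+ rootsSub N R := FreeAbelianGroup.lift fun b => b.zeta

theorem proj_genHeis (w : GenGrp N R) : Heis.proj _ (genHeis N R w) = genMu N R w :=
  DFunLike.congr_fun (f := (Heis.proj _).comp (genHeis N R)) (g := genMu N R)
    (genGrp_hom_ext fun b => by simp [genHeis, genMu, Heis.proj]) w

theorem yonProj_genYon (w : GenGrp N R) : yonProj N R (genYon N R w) = genMu N R w :=
  DFunLike.congr_fun (f := (yonProj N R).comp (genYon N R)) (g := genMu N R)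
    (genGrp_hom_ext fun b => by
      simp only [genYon, genMu, AddMonoidHom.comp_apply, FreeAbelianGroup.lift_apply_of]
      exact one_zsmul b.zeta) w

theorem nsmul_genGm (w : GenGrp N R) : N • genGm N R w = (genMu N R w).1 :=
  DFunLike.congr_fun (f := (nsmulAddMonoidHom N).comp (genGm N R))
    (g := (rootsSub N R).subtype.comp (genMu N R))
    (genGrp_hom_ext fun b => by
      simp [genGm, genMu, RootGen.zeta]) w

/-- The two lifts are compatible with the `2`-torsion structures. -/
theorem retr_genHeis (w : GenGrp N R) :
    Heis.retr _ (genHeis N R w) = symMap _ (yonRetr N R (genYon N R w)) :=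
  DFunLike.congr_fun (f := (Heis.retr _).comp (genHeis N R))
    (g := (symMap _).comp ((yonRetr N R).comp (genYon N R)))
    (genGrp_hom_ext fun b => by
      simp only [genYon, genHeis, AddMonoidHom.comp_apply, FreeAbelianGroup.lift_apply_of]
      change (2 : ℕ) • (0 : SymSq (rootsSub N R)) - symProd b.zeta b.zeta =
        symProd b.zeta (etaRetr N R b.eta)
      rw [b.etaRetr_eta, symProd_neg_right, nsmul_zero, zero_sub]) w

/-- The elements `w` of `GenGrp` whose lifts to the Heisenberg extension, to `μ_N ⊗ E_η` and to the
Kummer sequence come from elements `z` of `Sym²(μ_N)`, `t` of `μ_N ⊗ μ_N` and `c` of `μ_N` with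
`z = t + (N choose 2) c · c`. -/
def relSub : AddSubgroup (GenGrp N R × (rootsSub N R ⊗[ℤ] rootsSub N R) × rootsSub N R) where
  carrier := {x | genHeis N R x.1 = Heis.incl _ (symMap _ x.2.1 + halfSq N R x.2.2) ∧
    genYon N R x.1 = yonIncl N R x.2.1 ∧ genGm N R x.1 = x.2.2.1}
  zero_mem' := by simp
  add_mem' := by
    rintro x y ⟨h₁, h₂, h₃⟩ ⟨h₁', h₂', h₃'⟩
    refine ⟨?_, ?_, ?_⟩
    · simp only [Prod.fst_add, Prod.snd_add, map_add, h₁, h₁']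
      abel
    · simp only [Prod.fst_add, Prod.snd_add, map_add, h₂, h₂']
    · simp only [Prod.fst_add, Prod.snd_add, map_add, h₃, h₃', AddSubgroup.coe_add]
  neg_mem' := by
    rintro x ⟨h₁, h₂, h₃⟩
    refine ⟨?_, ?_, ?_⟩
    · simp only [Prod.fst_neg, Prod.snd_neg, map_neg, h₁, map_add]
      abel
    · simp only [Prod.fst_neg, Prod.snd_neg, map_neg, h₂]
    · simp only [Prod.fst_neg, Prod.snd_neg, map_neg, h₃, AddSubgroup.coe_neg]

variable {N R}

theorem genMu_eq_zero_of_mem_relSub {x} (hx : x ∈ relSub N R) : genMu N R x.1 = 0 := by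
  rw [← proj_genHeis, hx.1]
  rfl

/-- The `N`-fold lifts of `b ^ N` are `(N choose 2) ζ · ζ`, `0` and `ζ`, for `ζ = b ^ N`. -/
theorem nsmul_mem_relSub (b : RootGen N R) :
    (N • FreeAbelianGroup.of b, 0, b.zeta) ∈ relSub N R := by
  refine ⟨?_, ?_, ?_⟩
  · change genHeis N R (N • FreeAbelianGroup.of b) = _
    rw [map_nsmul, genHeis, FreeAbelianGroup.lift_apply_of, nsmul_heis, nsmul_rootsSub, map_zero,
      zero_add]
    rfl
  · change genYon N R (N • FreeAbelianGroup.of b) = _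
    rw [map_nsmul, genYon, FreeAbelianGroup.lift_apply_of, TensorProduct.smul_tmul',
      nsmul_rootsSub, TensorProduct.zero_tmul, map_zero]
  · change genGm N R (N • FreeAbelianGroup.of b) = _
    rw [map_nsmul, genGm, FreeAbelianGroup.lift_apply_of]
    rfl

/-- The lifts for `b ^ k` differ from the `k`-fold lifts for `b` by `-(k choose 2) ζ · ζ`,
`-(k choose 2) ζ ⊗ ζ` and `0`, for `ζ = b ^ N`. -/
theorem sub_mem_relSub {b b' : RootGen N R} {k : ℕ} (h : b'.1 = k • b.1) :
    (FreeAbelianGroup.of b' - k • FreeAbelianGroup.of b,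
      -(k.choose 2 • b.zeta ⊗ₜ[ℤ] b.zeta), 0) ∈ relSub N R := by
  have hζ : b'.zeta = k • b.zeta := Subtype.ext (by
    change N • b'.1 = k • N • b.1
    rw [h, nsmul_left_comm])
  refine ⟨?_, ?_, ?_⟩
  · change genHeis N R (FreeAbelianGroup.of b' - k • FreeAbelianGroup.of b) = _
    rw [map_sub, map_nsmul, genHeis, FreeAbelianGroup.lift_apply_of,
      FreeAbelianGroup.lift_apply_of, nsmul_heis, hζ, sub_eq_iff_eq_add, map_zero, add_zero]
    refine Heis.ext ?_ (zero_add _).symm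
    change 0 = -(k.choose 2 • symProd b.zeta b.zeta) + _ + symProd 0 _
    rw [symProd_zero_left, add_zero]
    exact (neg_add_cancel _).symm
  · change genYon N R (FreeAbelianGroup.of b' - k • FreeAbelianGroup.of b) = _
    rw [map_sub, map_nsmul, genYon, FreeAbelianGroup.lift_apply_of,
      FreeAbelianGroup.lift_apply_of, hζ, ← natCast_zsmul b.zeta, TensorProduct.smul_tmul,
      natCast_zsmul, RootGen.nsmul_eta h, TensorProduct.tmul_sub, TensorProduct.tmul_smul,
      sub_right_comm, sub_self, zero_sub, map_neg, neg_inj]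
    change b.zeta ⊗ₜ[ℤ] _ = _
    rw [map_nsmul, map_nsmul, TensorProduct.tmul_smul]
    rfl
  · change genGm N R (FreeAbelianGroup.of b' - k • FreeAbelianGroup.of b) = _
    rw [map_sub, map_nsmul, genGm, FreeAbelianGroup.lift_apply_of,
      FreeAbelianGroup.lift_apply_of, h, sub_self]
    rfl

variable {R' : Type u} [CommRing R']

/-- Functoriality of `GenGrp`. -/
def genMap (f : R →+* R') : GenGrp N R →+ GenGrp N R' := FreeAbelianGroup.map (RootGen.map f)

theorem genMap_of (f : R →+* R') (b : RootGen N R) :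
    genMap f (FreeAbelianGroup.of b) = FreeAbelianGroup.of (b.map f) :=
  FreeAbelianGroup.map_of_apply b

theorem genHeis_genMap (f : R →+* R') (w : GenGrp N R) :
    genHeis N R' (genMap f w) = Heis.map (rootsMap N f) (genHeis N R w) :=
  DFunLike.congr_fun (f := (genHeis N R').comp (genMap f))
    (g := (Heis.map (rootsMap N f)).comp (genHeis N R)) (genGrp_hom_ext fun b => by
      simp only [AddMonoidHom.comp_apply, genMap_of, genHeis, FreeAbelianGroup.lift_apply_of,
        RootGen.zeta_map]
      exact Heis.ext (map_zero _).symm rfl) w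

theorem genYon_genMap (f : R →+* R') (w : GenGrp N R) :
    genYon N R' (genMap f w) = yonMap N f (genYon N R w) :=
  DFunLike.congr_fun (f := (genYon N R').comp (genMap f))
    (g := (yonMap N f).comp (genYon N R)) (genGrp_hom_ext fun b => by
      simp only [AddMonoidHom.comp_apply, genMap_of, genYon, FreeAbelianGroup.lift_apply_of,
        RootGen.zeta_map, RootGen.eta_map]
      rfl) w

theorem genGm_genMap (f : R →+* R') (w : GenGrp N R) :
    genGm N R' (genMap f w) = unitsMap f (genGm N R w) :=
  DFunLike.congr_fun (f := (genGm N R').comp (genMap f))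
    (g := (unitsMap f).comp (genGm N R)) (genGrp_hom_ext fun b => by
      simp only [AddMonoidHom.comp_apply, genMap_of, genGm, FreeAbelianGroup.lift_apply_of]
      rfl) w

theorem genMu_genMap (f : R →+* R') (w : GenGrp N R) :
    genMu N R' (genMap f w) = rootsMap N f (genMu N R w) := by
  rw [← proj_genHeis, genHeis_genMap, ← proj_genHeis]
  rfl

theorem halfSq_rootsMap (f : R →+* R') (a : rootsSub N R) :
    halfSq N R' (rootsMap N f a) = symSqMap (rootsMap N f) (halfSq N R a) := by
  change _ = symSqMap (rootsMap N f) (N.choose 2 • symProd a a)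
  rw [map_nsmul, symSqMap_symProd]
  rfl

/-- Functoriality of `relSub`. -/
def relMap (f : R →+* R') : relSub N R →+ relSub N R' :=
  (((genMap f).prodMap ((tensorSqMap (rootsMap N f)).prodMap (rootsMap N f))).comp
    (relSub N R).subtype).codRestrict _ (by
      rintro ⟨x, h₁, h₂, h₃⟩
      refine ⟨?_, ?_, ?_⟩
      · change genHeis N R' (genMap f x.1) = Heis.incl _
          (symMap _ (tensorSqMap (rootsMap N f) x.2.1) + halfSq N R' (rootsMap N f x.2.2))
        rw [genHeis_genMap, h₁, halfSq_rootsMap, ← symSqMap_symMap, ← map_add]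
        exact Heis.ext rfl (map_zero (rootsMap N f))
      · change genYon N R' (genMap f x.1) = yonIncl N R' (tensorSqMap (rootsMap N f) x.2.1)
        rw [genYon_genMap, h₂]
        have : (yonMap N f).comp (yonIncl N R) =
            (yonIncl N R').comp (tensorSqMap (rootsMap N f)) :=
          tensor_hom_ext fun a b => rfl
        exact DFunLike.congr_fun this _
      · change genGm N R' (genMap f x.1) = unitsMap f x.2.2.1
        rw [genGm_genMap, h₃])

end Rings

/-- `R ↦ GenGrp N R`. -/
def genFun : CommRingCat.{u} ⥤ AddCommGrpCat.{u} where
  obj R := AddCommGrpCat.of (GenGrp N R)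
  map f := AddCommGrpCat.ofHom (genMap f.hom)
  map_id R := by
    ext1
    refine genGrp_hom_ext fun b => ?_
    exact genMap_of _ b
  map_comp f g := by
    ext1
    refine genGrp_hom_ext fun b => ?_
    exact (genMap_of _ b).trans ((congrArg (genMap g.hom) (genMap_of f.hom b)).trans
      (genMap_of g.hom _)).symm

/-- `R ↦ relSub N R`. -/
def relFun : CommRingCat.{u} ⥤ AddCommGrpCat.{u} where
  obj R := AddCommGrpCat.of (relSub N R)
  map f := AddCommGrpCat.ofHom (relMap f.hom)
  map_id R := by
    ext1
    refine AddMonoidHom.ext fun x => Subtype.ext (Prod.ext ?_ (Prod.ext ?_ rfl))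
    · exact ConcreteCategory.congr_hom ((genFun N).map_id R) x.1.1
    · exact ConcreteCategory.congr_hom ((muFun N ⋙ tensorSqFun).map_id R) x.1.2.1
  map_comp f g := by
    ext1
    refine AddMonoidHom.ext fun x => Subtype.ext (Prod.ext ?_ (Prod.ext ?_ rfl))
    · exact ConcreteCategory.congr_hom ((genFun N).map_comp f g) x.1.1
    · exact ConcreteCategory.congr_hom ((muFun N ⋙ tensorSqFun).map_comp f g) x.1.2.1

/-- `GenGrp → H⁽¹⁾(μ_N)`. -/
def genHeisNat : genFun.{u} N ⟶ muFun N ⋙ heisFun where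
  app R := AddCommGrpCat.ofHom (genHeis N R)
  naturality R R' f := by ext x; exact genHeis_genMap f.hom x

/-- `GenGrp → μ_N ⊗ E_η`. -/
def genYonNat : genFun.{u} N ⟶ yonFun N where
  app R := AddCommGrpCat.ofHom (genYon N R)
  naturality R R' f := by ext x; exact genYon_genMap f.hom x

/-- `GenGrp → 𝔾ₘ`. -/
def genGmNat : genFun.{u} N ⟶ gmFun where
  app R := AddCommGrpCat.ofHom (genGm N R)
  naturality R R' f := by ext x; exact genGm_genMap f.hom x

/-- `GenGrp → μ_N`. -/
def genMuNat : genFun.{u} N ⟶ muFun N where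
  app R := AddCommGrpCat.ofHom (genMu N R)
  naturality R R' f := by ext x; exact genMu_genMap f.hom x

/-- The homomorphism `a ↦ (N choose 2) a · a` from `μ_N` to `Sym²(μ_N)`. -/
def halfSqNat : muFun.{u} N ⟶ muFun N ⋙ symSqFun where
  app R := AddCommGrpCat.ofHom (halfSq N R)
  naturality R R' f := by ext x; exact halfSq_rootsMap f.hom x

/-- The component `w` of an element of `relSub`. -/
def relGen : relFun.{u} N ⟶ genFun N where
  app R := AddCommGrpCat.ofHom ((AddMonoidHom.fst _ _).comp (relSub N R).subtype)

/-- The component `t` of an element of `relSub`. -/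
def relTensor : relFun.{u} N ⟶ muFun N ⋙ tensorSqFun where
  app R := AddCommGrpCat.ofHom
    ((AddMonoidHom.fst _ _).comp ((AddMonoidHom.snd _ _).comp (relSub N R).subtype))

/-- The component `c` of an element of `relSub`. -/
def relMu : relFun.{u} N ⟶ muFun N where
  app R := AddCommGrpCat.ofHom
    ((AddMonoidHom.snd _ _).comp ((AddMonoidHom.snd _ _).comp (relSub N R).subtype))

theorem genHeisNat_proj :
    genHeisNat.{u} N ≫ Functor.whiskerLeft (muFun N) heisProj = genMuNat N := by
  ext R x
  exact proj_genHeis N R x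

theorem genYonNat_proj : genYonNat.{u} N ≫ yonProjNat N = genMuNat N := by
  ext R x
  exact yonProj_genYon N R x

theorem genGmNat_pow : genGmNat.{u} N ≫ gmPow N = genMuNat N ≫ muIncl N := by
  ext R x
  exact nsmul_genGm N R x

theorem genHeisNat_retr :
    genHeisNat.{u} N ≫ Functor.whiskerLeft (muFun N) heisRetr =
      (genYonNat N ≫ yonRetrNat N) ≫ Functor.whiskerLeft (muFun N) symNat := by
  ext R x
  exact retr_genHeis N R x

theorem two_nsmul_halfSqNat : (2 : ℕ) • halfSqNat.{u} N = 0 := by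
  ext R x
  exact two_nsmul_halfSq N R x

theorem relGen_genHeisNat :
    relGen.{u} N ≫ genHeisNat N =
      (relTensor N ≫ Functor.whiskerLeft (muFun N) symNat + relMu N ≫ halfSqNat N) ≫
        Functor.whiskerLeft (muFun N) heisIncl := by
  ext R x
  exact x.2.1

theorem relGen_genYonNat : relGen.{u} N ≫ genYonNat N = relTensor N ≫ yonInclNat N := by
  ext R x
  exact x.2.2.1

theorem relGen_genGmNat : relGen.{u} N ≫ genGmNat N = relMu N ≫ muIncl N := by
  ext R x
  exact x.2.2.2

theorem relGen_genMuNat : relGen.{u} N ≫ genMuNat N = 0 := by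
  ext R x
  exact genMu_eq_zero_of_mem_relSub x.2

end

/-! ### Exactness of the presentation -/

noncomputable section

variable {N : ℕ}

theorem etaleLocally_exists_rootGen (hN : 1 ≤ N) {R : CommRingCat.{u}} (hR : IsUnit (N : R)) :
    EtaleLocally R fun R' _ => ∃ b : RootGen N R',
      (Polynomial.cyclotomic (N * N) R').IsRoot (Additive.toMul b.1 : R'ˣ) := by
  have h : IsUnit ((N * N : ℕ) : R) := by rw [Nat.cast_mul]; exact hR.mul hR
  refine (etaleLocally_exists_isRoot_cyclotomic h (Nat.mul_ne_zero (by omega) (by omega))).mono ?_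
  rintro R' f ⟨b, hb⟩
  exact ⟨RootGen.ofIsRoot hN hb, hb⟩

theorem RootGen.pow_eq_one {R : Type u} [CommRing R] (b : RootGen N R) :
    (Additive.toMul b.1) ^ (N * N) = 1 :=
  (congrArg Additive.toMul ((mul_nsmul' b.1 N N).trans b.2.1) :)

theorem isRoot_rootGen_map {R R' : Type u} [CommRing R] [CommRing R'] {b : RootGen N R}
    (hb : (Polynomial.cyclotomic (N * N) R).IsRoot (Additive.toMul b.1 : Rˣ)) (f : R →+* R') :
    (Polynomial.cyclotomic (N * N) R').IsRoot (Additive.toMul (b.map f).1 : R'ˣ) := by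
  rw [← Polynomial.map_cyclotomic (N * N) f]
  exact hb.map

/-- Modulo the relations, `GenGrp` is étale-locally generated by any primitive `N²`-th root of
unity. -/
theorem etaleLocally_exists_relSub (hN : 1 ≤ N) {R : CommRingCat.{u}} (hR : IsUnit (N : R))
    {b : RootGen N R} (hb : (Polynomial.cyclotomic (N * N) R).IsRoot (Additive.toMul b.1 : Rˣ))
    (w : GenGrp N R) :
    EtaleLocally R fun R' f => ∃ (m : ℤ) (k : relSub N R'),
      k.1.1 = genMap f.hom w - m • FreeAbelianGroup.of (b.map f.hom) := by
  have hNN : N * N ≠ 0 := Nat.mul_ne_zero (by omega) (by omega)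
  -- The statement for all base changes of `w` is stable under sums.
  suffices ∀ (R₁ : CommRingCat.{u}) (g : R ⟶ R₁), EtaleLocally R₁ fun R' f =>
      ∃ (m : ℤ) (k : relSub N R'), k.1.1 =
        genMap (g ≫ f).hom w - m • FreeAbelianGroup.of (b.map (g ≫ f).hom) by
    simpa only [Category.id_comp] using this R (𝟙 R)
  induction w using FreeAbelianGroup.induction_on with
  | zero => exact fun R₁ g => .of_id ⟨0, 0, by rw [map_zero, zero_zsmul, sub_zero]; rfl⟩
  | of x =>
    intro R₁ g
    have hR₁ := isUnit_natCast_of_hom g hR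
    have hR₁' : IsUnit ((N * N : ℕ) : R₁) := by rw [Nat.cast_mul]; exact hR₁.mul hR₁
    refine (etaleLocally_exists_eq_pow hR₁' hNN (isRoot_rootGen_map hb g.hom)
      (RootGen.pow_eq_one (x.map g.hom))).mono ?_
    rintro R₂ f ⟨k, hk⟩
    refine ⟨k, ⟨_, sub_mem_relSub (b := b.map (g ≫ f).hom) (b' := x.map (g ≫ f).hom) (k := k)
      (congrArg Additive.ofMul hk)⟩, ?_⟩
    rw [natCast_zsmul, genMap_of]
  | neg x hx =>
    intro R₁ g
    refine (hx R₁ g).mono ?_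
    rintro R₂ f ⟨m, k, hk⟩
    refine ⟨-m, -k, ?_⟩
    rw [map_neg, neg_zsmul]
    change -k.1.1 = _
    rw [hk]
    abel
  | add x y hx hy =>
    intro R₁ g
    refine (hx R₁ g).bind ?_
    rintro R₂ f ⟨m, k, hk⟩
    refine (hy R₂ (g ≫ f)).mono ?_
    rintro R₃ f' ⟨m', k', hk'⟩
    refine ⟨m + m', relMap f'.hom k + k', ?_⟩
    have h₁ : (relMap f'.hom k).1.1 = genMap (g ≫ f ≫ f').hom x -
        m • FreeAbelianGroup.of (b.map (g ≫ f ≫ f').hom) := by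
      refine (congrArg (genMap f'.hom) hk).trans ?_
      rw [map_sub, map_zsmul, genMap_of]
      have := ConcreteCategory.congr_hom ((genFun N).map_comp (g ≫ f) f') x
      exact congrArg₂ _ (this.symm) rfl
    rw [Category.assoc] at hk'
    rw [map_add, add_zsmul]
    change (relMap f'.hom k).1.1 + k'.1.1 = _
    rw [h₁, hk']
    abel

theorem etaleLocally_exists_of_genMu_eq_zero (hN : 1 ≤ N) {R : CommRingCat.{u}}
    (hR : IsUnit (N : R)) {w : GenGrp N R} (hw : genMu N R w = 0) :
    EtaleLocally R fun R' f => ∃ k : relSub N R', k.1.1 = genMap f.hom w := by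
  refine (etaleLocally_exists_rootGen hN hR).bind ?_
  rintro R₁ f ⟨b, hb⟩
  have hR₁ := isUnit_natCast_of_hom f hR
  refine (etaleLocally_exists_relSub hN hR₁ hb (genMap f.hom w)).bind ?_
  rintro R₂ g ⟨m, k, hk⟩ p
  have hR₂ := isUnit_natCast_of_hom g hR₁
  have : Nontrivial R₂ := p.nontrivial
  -- The order of `b ^ N` is `N`, so `m` is a multiple of `N`.
  have hdvd : (N : ℤ) ∣ m := by
    have h1 := genMu_eq_zero_of_mem_relSub k.2
    rw [hk, map_sub, genMu_genMap, genMu_genMap, hw, map_zero, map_zero, zero_sub, neg_eq_zero,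
      map_zsmul, genMu, FreeAbelianGroup.lift_apply_of] at h1
    have h2 : (Additive.toMul (b.map g.hom).1) ^ ((N : ℤ) * m) = 1 := by
      have h3 : m • N • (b.map g.hom).1 = 0 := congrArg Subtype.val h1
      rw [← natCast_zsmul, smul_smul, mul_comm] at h3
      exact (congrArg Additive.toMul h3 :)
    have h4 := dvd_of_zpow_eq_one (by rw [Nat.cast_mul]; exact hR₂.mul hR₂)
      (isRoot_rootGen_map hb g.hom) h2
    rw [Nat.cast_mul] at h4
    exact (mul_dvd_mul_iff_left (by positivity)).1 h4
  obtain ⟨l, rfl⟩ := hdvd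
  refine EtaleLocally.of_id ?_ p
  refine ⟨k + l • ⟨_, nsmul_mem_relSub (b.map g.hom)⟩, ?_⟩
  change k.1.1 + l • (N • FreeAbelianGroup.of (b.map g.hom)) = _
  rw [hk, ← natCast_zsmul, smul_smul, mul_comm l, sub_add_cancel, Category.comp_id]
  exact (ConcreteCategory.congr_hom ((genFun N).map_comp f g) w).symm

variable {S : Scheme.{u}}

theorem epi_genMu (hN : 1 ≤ N) (hS : IsUnit (N : Γ(S, ⊤))) : Epi (shMap S (genMuNat N)) := by
  have hNN : N * N ≠ 0 := Nat.mul_ne_zero (by omega) (by omega)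
  refine epi_shMap hS _ fun R hR y => ?_
  -- Lift `y` to an `N²`-th root of unity, which is a power of a generator.
  refine (etaleLocally_exists_pow_eq hR (by omega) (Additive.toMul (y : rootsSub N R).1)).bind ?_
  rintro R₁ f₁ ⟨x, hx⟩
  have hR₁ := isUnit_natCast_of_hom f₁ hR
  refine (etaleLocally_exists_rootGen hN hR₁).bind ?_
  rintro R₂ f₂ ⟨b, hb⟩
  have hR₂ := isUnit_natCast_of_hom f₂ hR₁
  have hR₂' : IsUnit ((N * N : ℕ) : R₂) := by rw [Nat.cast_mul]; exact hR₂.mul hR₂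
  have hx' : (Units.map (f₂.hom : R₁ →* R₂) x) ^ (N * N) = 1 := by
    rw [← map_pow, pow_mul, hx, ← map_pow,
      show (Additive.toMul (y : rootsSub N R).1) ^ N = 1 from y.2, map_one, map_one]
  refine (etaleLocally_exists_eq_pow hR₂' hNN hb hx').mono ?_
  rintro R₃ f₃ ⟨k, hk⟩
  refine ⟨k • FreeAbelianGroup.of (b.map f₃.hom), ?_⟩
  change genMu N R₃ (k • FreeAbelianGroup.of (b.map f₃.hom)) =
    rootsMap N (f₁ ≫ f₂ ≫ f₃).hom y
  rw [map_nsmul, genMu, FreeAbelianGroup.lift_apply_of]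
  refine Subtype.ext ?_
  have h1 : N • k • (b.map f₃.hom).1 =
      unitsMap f₃.hom (unitsMap f₂.hom (N • Additive.ofMul x)) := by
    rw [map_nsmul, map_nsmul]
    exact congrArg (N • Additive.ofMul ·) hk.symm
  exact (nsmul_left_comm _ _ _).trans (h1.trans
    (congrArg (fun t => unitsMap f₃.hom (unitsMap f₂.hom (Additive.ofMul t))) hx))

theorem exact_relGen_genMu (hN : 1 ≤ N) (hS : IsUnit (N : Γ(S, ⊤))) :
    (ShortComplex.mk (shMap S (relGen N)) (shMap S (genMuNat N))
      (shMap_comp_eq_zero S _ _ (relGen_genMuNat N))).Exact :=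
  exact_shMap hS _ _ _ fun _ hR _ hy =>
    etaleLocally_exists_of_genMu_eq_zero hN hR hy

end

/-! ### Composites of coboundaries in an abelian category -/

noncomputable section

section Existence

variable {C : Type u} [Category.{v} C] [Abelian C]

theorem IsShortExact.exists_desc {P E Q X : C} {i : P ⟶ E} {p : E ⟶ Q} (h : IsShortExact i p)
    (f : E ⟶ X) (hf : i ≫ f = 0) : ∃ g : Q ⟶ X, p ≫ g = f := by
  obtain ⟨w, h⟩ := h
  have := h.epi_g
  exact ⟨h.exact.desc f hf, h.exact.g_desc f hf⟩

theorem IsShortExact.mono {P E Q : C} {i : P ⟶ E} {p : E ⟶ Q} (h : IsShortExact i p) : Mono i :=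
  h.choose_spec.mono_f

theorem IsShortExact.epi {P E Q : C} {i : P ⟶ E} {p : E ⟶ Q} (h : IsShortExact i p) : Epi p :=
  h.choose_spec.epi_g

theorem IsShortExact.exists_ext {P E Q X : C} {i : P ⟶ E} {p : E ⟶ Q} (h : IsShortExact i p)
    [Injective X] (f : P ⟶ X) : ∃ g : E ⟶ X, i ≫ g = f := by
  have := h.mono
  exact ⟨Injective.factorThru f i, Injective.comp_factorThru f i⟩

variable {A : C} {I : InjectiveResolution A} {P E Q G K : C} {i : P ⟶ E} {p : E ⟶ Q}

theorem IsShortExact.nonempty_cobComp (h : IsShortExact i p) {n : ℕ} (c : MapsPt I P n) :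
    Nonempty (CobComp i p c) := by
  have := I.injective n
  have := h.epi
  obtain ⟨l, hl⟩ := h.exists_ext c.hom
  obtain ⟨g, hg⟩ := h.exists_desc (l ≫ I.cocomplex.d n (n + 1)) (by
    rw [← Category.assoc, hl, c.closed])
  refine ⟨⟨l, hl, ⟨g, ?_⟩, hg⟩⟩
  rw [← cancel_epi p, ← Category.assoc, hg, Category.assoc, HomologicalComplex.d_comp_d,
    Limits.comp_zero, Limits.comp_zero]

theorem IsShortExact.nonempty_extTors (h : IsShortExact i p) {ρ : E ⟶ P}
    (hρ : i ≫ ρ = (2 : ℕ) • 𝟙 P) {n : ℕ} {c : MapsPt I P n} (b : CobComp i p c) :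
    Nonempty (ExtTors ρ b) := by
  have := h.epi
  obtain ⟨g, hg⟩ := h.exists_desc ((2 : ℕ) • b.lift - ρ ≫ c.hom) (by
    rw [Preadditive.comp_sub, Preadditive.comp_nsmul, b.incl_lift, ← Category.assoc, hρ,
      Preadditive.nsmul_comp, Category.id_comp, sub_self])
  refine ⟨⟨⟨g, ?_⟩, hg⟩⟩
  rw [← cancel_epi p, ← Category.assoc, hg, Preadditive.sub_comp, Category.assoc, c.closed,
    Limits.comp_zero, sub_zero, Preadditive.nsmul_comp, Preadditive.comp_nsmul, b.proj_pt]

theorem IsShortExact.nonempty_whiskerTors (h : IsShortExact i p) {n : ℕ}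
    {c : MapsPt I P (n + 1)} (t : TwoTors I c) (b : CobComp i p c) :
    Nonempty (WhiskerTors t b) := by
  have := I.injective n
  have := h.epi
  obtain ⟨l, hl⟩ := h.exists_ext t.htpy
  obtain ⟨g, hg⟩ := h.exists_desc ((2 : ℕ) • b.lift - l ≫ I.cocomplex.d n (n + 1)) (by
    rw [Preadditive.comp_sub, Preadditive.comp_nsmul, b.incl_lift, ← Category.assoc, hl,
      t.d_htpy, sub_self])
  refine ⟨⟨⟨g, ?_⟩, l, hl, hg⟩⟩
  rw [← cancel_epi p, ← Category.assoc, hg, Preadditive.sub_comp, Category.assoc,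
    HomologicalComplex.d_comp_d, Limits.comp_zero, sub_zero, Preadditive.nsmul_comp,
    Preadditive.comp_nsmul, b.proj_pt]

theorem nonempty_composite {j : Q ⟶ G} {q : G ⟶ K} (h : IsShortExact i p)
    (h' : IsShortExact j q) {ρ : E ⟶ P} (hρ : i ≫ ρ = (2 : ℕ) • 𝟙 P) (a : MapsPt I P 0) :
    Nonempty (Composite i p ρ j q a) := by
  obtain ⟨b⟩ := h.nonempty_cobComp a
  obtain ⟨t⟩ := h.nonempty_extTors hρ b
  obtain ⟨b'⟩ := h'.nonempty_cobComp b.pt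
  obtain ⟨t'⟩ := h'.nonempty_whiskerTors t.toTwoTors b'
  exact ⟨⟨b, t, b', t'⟩⟩

end Existence

section Trivialization

variable {C : Type u} [Category.{v} C] [Abelian C]
  {K W M G H Y L₀ L₁ : C} {j : M ⟶ G} {k : G ⟶ G} {π : W ⟶ M} {aH : W ⟶ H} {aY : W ⟶ Y}
  {aG : W ⟶ G} {d : L₀ ⟶ L₁} {φ : M ⟶ L₀} {lH : H ⟶ L₀} {lY : Y ⟶ L₀} {mH mY : G ⟶ L₁}
  {nH nY : G ⟶ L₀}

variable (j k π aH aY aG d φ lH lY mH mY nH nY) in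
/-- The choices which produce an isomorphism `T` between two composites of coboundaries `H` and `Y`
with the coboundary of `0 ⟶ M ⟶ G ⟶ G ⟶ 0`, and its compatibility `R` with the `2`-torsion
structures. The two extensions are compared on a cover `W` of `M`, with lifts to both extensions and
to `G`:
* `c` is an extension of the cocycle `φ` to `G`, and `e` represents the pushout along `φ` of the
  extension `G` of `G` by `M`;
* `s` is a trivialization of `2 e`;
* `q` is an isomorphism between the difference of the extensions `H` and `Y` of `M` and the
  restriction of `e` to `M`, and `qt` is an extension of `q` to `G`;
* `T` and `R` are determined by these choices. -/
structure TrivData where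
  c : G ⟶ L₀
  incl_c : j ≫ c = φ
  e : G ⟶ L₁
  pow_e : k ≫ e = c ≫ d
  s : G ⟶ L₀
  pow_s : k ≫ s = (2 : ℕ) • c
  q : M ⟶ L₀
  cover_q : π ≫ q = aH ≫ lH - aY ≫ lY - aG ≫ c
  qt : G ⟶ L₀
  incl_qt : j ≫ qt = q
  T : G ⟶ L₁
  pow_T : k ≫ T = mH - mY - e - qt ≫ d
  R : G ⟶ L₀
  pow_R : k ≫ R = nH - nY - (2 : ℕ) • qt - s

/-- Here `K ⟶ W ⟶ M` presents `M`, and `μ` is the component in `M` of a relation: by `hr`, the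
difference of the lifts to `H` and `Y` of a relation is the image of this component under `φ`. The
hypotheses `hnH` and `hnY` have the same `v` because the lifts to `H` and `Y` are compatible with
the `2`-torsion structures. -/
theorem nonempty_trivData [Injective L₀] (hjk : IsShortExact j k) {r : K ⟶ W} {w : r ≫ π = 0}
    (hrπ : (ShortComplex.mk r π w).Exact) [Epi π] (hπ : aG ≫ k = π ≫ j) {μ : K ⟶ M}
    (hμ : r ≫ aG = μ ≫ j) (hφ : φ ≫ d = 0) (h2φ : (2 : ℕ) • φ = 0)
    (hr : r ≫ aH ≫ lH - r ≫ aY ≫ lY = μ ≫ φ)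
    (hmH : π ≫ j ≫ mH = aH ≫ lH ≫ d) (hmY : π ≫ j ≫ mY = aY ≫ lY ≫ d) {v : W ⟶ L₀}
    (hnH : π ≫ j ≫ nH = (2 : ℕ) • (aH ≫ lH) - v)
    (hnY : π ≫ j ≫ nY = (2 : ℕ) • (aY ≫ lY) - v) :
    Nonempty (TrivData j k π aH aY aG d φ lH lY mH mY nH nY) := by
  have : Epi (ShortComplex.mk r π w).g := inferInstanceAs (Epi π)
  obtain ⟨c, hc⟩ := hjk.exists_ext φ
  obtain ⟨e, he⟩ := hjk.exists_desc (c ≫ d) (by rw [← Category.assoc, hc, hφ])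
  obtain ⟨s, hs⟩ := hjk.exists_desc ((2 : ℕ) • c) (by rw [Preadditive.comp_nsmul, hc, h2φ])
  obtain ⟨q, hq⟩ : ∃ q : M ⟶ L₀, π ≫ q = aH ≫ lH - aY ≫ lY - aG ≫ c := by
    have h0 : r ≫ (aH ≫ lH - aY ≫ lY - aG ≫ c) = 0 := by
      rw [Preadditive.comp_sub, Preadditive.comp_sub, hr, ← Category.assoc r aG c, hμ,
        Category.assoc, hc, sub_self]
    exact ⟨hrπ.desc _ h0, hrπ.g_desc _ h0⟩
  obtain ⟨qt, hqt⟩ := hjk.exists_ext q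
  have hG {X : C} (f f' : G ⟶ X) (hf : k ≫ f = f') : π ≫ j ≫ f = aG ≫ f' := by
    rw [← Category.assoc, ← hπ, Category.assoc, hf]
  obtain ⟨T, hT⟩ := hjk.exists_desc (mH - mY - e - qt ≫ d) (by
    rw [← cancel_epi π]
    simp only [Preadditive.comp_sub, hmH, hmY, hG e _ he, Limits.comp_zero]
    rw [← Category.assoc j qt d, hqt, ← Category.assoc π q d, hq]
    simp only [Preadditive.sub_comp, Category.assoc]
    abel)
  obtain ⟨R, hR⟩ := hjk.exists_desc (nH - nY - (2 : ℕ) • qt - s) (by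
    rw [← cancel_epi π]
    simp only [Preadditive.comp_sub, Preadditive.comp_nsmul, hnH, hnY, hG s _ hs,
      Limits.comp_zero, hqt, hq]
    abel)
  exact ⟨⟨c, hc, e, he, s, hs, q, hq, qt, hqt, T, hT, R, hR⟩⟩

namespace TrivData

variable (D : TrivData j k π aH aY aG d φ lH lY mH mY nH nY)

theorem T_comp_d [Epi k] {L₂ : C} {d' : L₁ ⟶ L₂} (hd : d ≫ d' = 0) {gH gY : G ⟶ L₂}
    (hH : k ≫ gH = mH ≫ d') (hY : k ≫ gY = mY ≫ d') : D.T ≫ d' = gH - gY := by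
  have he : D.e ≫ d' = 0 := by
    rw [← cancel_epi k, ← Category.assoc, D.pow_e, Category.assoc, hd, Limits.comp_zero,
      Limits.comp_zero]
  rw [← cancel_epi k, ← Category.assoc, D.pow_T]
  simp only [Preadditive.sub_comp, Preadditive.comp_sub, Category.assoc, hd, he, hH, hY,
    Limits.comp_zero, sub_zero]

theorem s_comp_d [Epi k] : D.s ≫ d = (2 : ℕ) • D.e := by
  rw [← cancel_epi k, ← Category.assoc, D.pow_s, Preadditive.comp_nsmul, D.pow_e,
    Preadditive.nsmul_comp]

theorem R_comp_d [Epi k] {vH vY : G ⟶ L₁} (hH : k ≫ vH = (2 : ℕ) • mH - nH ≫ d)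
    (hY : k ≫ vY = (2 : ℕ) • mY - nY ≫ d) : D.R ≫ d = (2 : ℕ) • D.T - (vH - vY) := by
  rw [← cancel_epi k, ← Category.assoc, D.pow_R]
  simp only [Preadditive.sub_comp, Preadditive.comp_sub, Preadditive.comp_nsmul,
    Preadditive.nsmul_comp, D.pow_T, D.s_comp_d, hH, hY]
  abel

/-- Two pairs `(T, R)` constructed from two pairs of representatives are isomorphic along any
comparison `x`, `y`, `z` of the representatives. -/
theorem exists_comparison (hjk : IsShortExact j k) [Epi π]
    (hπ : aG ≫ k = π ≫ j) {lH' : H ⟶ L₀} {lY' : Y ⟶ L₀} {mH' mY' : G ⟶ L₁} {nH' nY' : G ⟶ L₀}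
    (D' : TrivData j k π aH aY aG d φ lH' lY' mH' mY' nH' nY')
    {uH uY : M ⟶ L₀} {xH xY zH zY : G ⟶ L₀} {yH yY : G ⟶ L₁}
    (huH : π ≫ uH = aH ≫ (lH - lH')) (huY : π ≫ uY = aY ≫ (lY - lY'))
    (hxH : j ≫ xH = uH) (hxY : j ≫ xY = uY)
    (hyH : k ≫ yH = mH - mH' - xH ≫ d) (hyY : k ≫ yY = mY - mY' - xY ≫ d)
    (hzH : k ≫ zH = nH - nH' - (2 : ℕ) • xH) (hzY : k ≫ zY = nY - nY' - (2 : ℕ) • xY) :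
    ∃ w : G ⟶ L₀, w ≫ d = (D.T - yH + yY) - D'.T ∧
      (2 : ℕ) • w = (D.R - zH + zY) - D'.R := by
  have := hjk.epi
  -- `s₀` compares the two extensions of `φ` to `G`.
  obtain ⟨s₀, hs₀⟩ := hjk.exists_desc (D.c - D'.c) (by
    rw [Preadditive.comp_sub, D.incl_c, D'.incl_c, sub_self])
  have hs₀d : s₀ ≫ d = D.e - D'.e := by
    rw [← cancel_epi k, ← Category.assoc, hs₀, Preadditive.sub_comp, Preadditive.comp_sub,
      D.pow_e, D'.pow_e]
  have h2s₀ : (2 : ℕ) • s₀ = D.s - D'.s := by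
    rw [← cancel_epi k, Preadditive.comp_nsmul, hs₀, Preadditive.comp_sub, D.pow_s, D'.pow_s,
      nsmul_sub]
  have hG : π ≫ j ≫ s₀ = aG ≫ (D.c - D'.c) := by
    rw [← hs₀, ← Category.assoc, ← hπ, Category.assoc]
  obtain ⟨w, hw⟩ := hjk.exists_desc (D'.qt - D.qt + xH - xY - s₀) (by
    rw [← cancel_epi π]
    simp only [Preadditive.comp_sub, Preadditive.comp_add, D.incl_qt, D'.incl_qt, D.cover_q,
      D'.cover_q, hxH, hxY, huH, huY, hG, Limits.comp_zero]
    abel)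
  refine ⟨w, ?_, ?_⟩
  · rw [← cancel_epi k, ← Category.assoc, hw]
    simp only [Preadditive.comp_sub, Preadditive.comp_add, Preadditive.sub_comp,
      Preadditive.add_comp, D.pow_T, D'.pow_T, hyH, hyY, hs₀d]
    abel
  · rw [← cancel_epi k, Preadditive.comp_nsmul, hw]
    simp only [Preadditive.comp_sub, Preadditive.comp_add, D.pow_R, D'.pow_R, hzH, hzY,
      nsmul_sub, nsmul_add, h2s₀]
    abel

end TrivData

end Trivialization

end

/-! ### The isomorphism `T` and its compatibility `R` -/

noncomputable section

variable {N : ℕ} {S S' : Scheme.{u}}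

theorem incl_heisRetr : heiI N S ≫ heiR N S = (2 : ℕ) • 𝟙 (SymMu N S) := by
  have h : Functor.whiskerLeft (muFun.{u} N) heisIncl ≫ Functor.whiskerLeft (muFun N) heisRetr =
      (2 : ℕ) • 𝟙 (muFun N ⋙ symSqFun) := by
    ext R x
    exact Heis.retr_incl _ x
  rw [← shMap_comp, h, shMap_nsmul]
  exact congrArg ((2 : ℕ) • ·) (((restrictTo S).congr_map (assocSheaf.map_id _)).trans
    ((restrictTo S).map_id _))

theorem incl_yonRetr : yonI N S ≫ yonR N S = (2 : ℕ) • 𝟙 (Mu2 N S) := by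
  have h : yonInclNat.{u} N ≫ yonRetrNat N = (2 : ℕ) • 𝟙 (muFun N ⋙ tensorSqFun) := by
    ext R : 2
    refine ConcreteCategory.hom_ext _ _ fun t => ?_
    exact yonRetr_yonIncl N R t
  rw [← shMap_comp, h, shMap_nsmul]
  exact congrArg ((2 : ℕ) • ·) (((restrictTo S).congr_map (assocSheaf.map_id _)).trans
    ((restrictTo S).map_id _))

theorem nonempty_productRep (hN : 1 ≤ N) (hS : IsUnit (N : Γ(S, ⊤))) :
    Nonempty (ProductRep N S) := by
  have := isIso_symS hN hS
  obtain ⟨I⟩ : Nonempty (InjectiveResolution (Mu2 N S)) := HasInjectiveResolution.out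
  obtain ⟨cH⟩ := nonempty_composite (heisenberg_exact hS) (kummer_exact hN hS) incl_heisRetr
    (MapsPt.ofHom I (asIso (symS N S)).inv)
  obtain ⟨cY⟩ := nonempty_composite (yoneda_exact hN hS) (kummer_exact hN hS) incl_yonRetr
    (MapsPt.ofHom I (𝟙 _))
  exact ⟨⟨I, asIso (symS N S), rfl, cH, cY⟩⟩

/-- The choices which produce `T` and `R` for the representatives `r`. -/
abbrev ProductRep.Triv (r : ProductRep N S) :=
  TrivData (kumI N S) (kumP N S) (shMap S (genMuNat N)) (shMap S (genHeisNat N))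
    (shMap S (genYonNat N)) (shMap S (genGmNat N)) (r.res.cocomplex.d 0 1)
    (shMap S (halfSqNat N) ≫ r.sym.inv ≫ augment r.res) r.HΨ.ext.lift r.YΨ.ext.lift
    r.HΨ.comp.lift r.YΨ.comp.lift r.HΨ.compTors.lift r.YΨ.compTors.lift

theorem genGm_kumP :
    shMap S (genGmNat N) ≫ kumP N S = shMap S (genMuNat N) ≫ kumI N S := by
  rw [← shMap_comp, ← shMap_comp, genGmNat_pow]

theorem genHeis_heiP : shMap S (genHeisNat N) ≫ heiP N S = shMap S (genMuNat N) := by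
  rw [← shMap_comp, genHeisNat_proj]

theorem genYon_yonP : shMap S (genYonNat N) ≫ yonP N S = shMap S (genMuNat N) := by
  rw [← shMap_comp, genYonNat_proj]

theorem genHeis_heiR :
    shMap S (genHeisNat N) ≫ heiR N S = (shMap S (genYonNat N) ≫ yonR N S) ≫ symS N S := by
  rw [← shMap_comp, ← shMap_comp, ← shMap_comp, genHeisNat_retr]

theorem ProductRep.nonempty_triv (hN : 1 ≤ N) (hS : IsUnit (N : Γ(S, ⊤))) (r : ProductRep N S) :
    Nonempty r.Triv := by
  have : Injective (r.res.cocomplex.X 0) := r.res.injective 0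
  have := epi_genMu hN hS
  have hI : augment r.res ≫ r.res.cocomplex.d 0 1 = 0 := r.res.ι_f_zero_comp_complex_d
  have hsym : symS N S ≫ r.sym.inv = 𝟙 _ := by rw [← r.sym_hom, Iso.hom_inv_id]
  have hHl : heiI N S ≫ r.HΨ.ext.lift = r.sym.inv ≫ augment r.res := r.HΨ.ext.incl_lift
  have hYl : yonI N S ≫ r.YΨ.ext.lift = augment r.res :=
    r.YΨ.ext.incl_lift.trans (Category.id_comp _)
  have hHτ : heiP N S ≫ r.HΨ.extTors.htpy =
      (2 : ℕ) • r.HΨ.ext.lift - heiR N S ≫ r.sym.inv ≫ augment r.res := r.HΨ.extTors.proj_htpy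
  have hYτ : yonP N S ≫ r.YΨ.extTors.htpy =
      (2 : ℕ) • r.YΨ.ext.lift - yonR N S ≫ augment r.res := by
    rw [r.YΨ.extTors.proj_htpy]
    exact congrArg (_ - yonR N S ≫ ·) (Category.id_comp _)
  refine nonempty_trivData (kummer_exact hN hS) (exact_relGen_genMu hN hS) genGm_kumP
    (μ := shMap S (relMu N)) (v := shMap S (genYonNat N) ≫ yonR N S ≫ augment r.res)
    ?_ ?_ ?_ ?_ ?_ ?_ ?_ ?_
  · rw [← shMap_comp, relGen_genGmNat, shMap_comp]
  · rw [Category.assoc, Category.assoc, hI, Limits.comp_zero, Limits.comp_zero]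
  · rw [← Preadditive.nsmul_comp, ← shMap_nsmul, two_nsmul_halfSqNat, shMap_zero,
      Limits.zero_comp]
  · rw [← Category.assoc, ← shMap_comp, relGen_genHeisNat, shMap_comp, Category.assoc, hHl,
      ← Category.assoc (shMap S (relGen N)), ← shMap_comp, relGen_genYonNat, shMap_comp,
      Category.assoc, hYl, shMap_add, shMap_comp, shMap_comp, Preadditive.add_comp,
      Category.assoc, ← Category.assoc (symS N S), hsym, Category.id_comp, add_sub_cancel_left,
      Category.assoc]
  · rw [r.HΨ.comp.incl_lift, ← genHeis_heiP, Category.assoc]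
    exact congrArg _ r.HΨ.ext.proj_pt
  · rw [r.YΨ.comp.incl_lift, ← genYon_yonP, Category.assoc]
    exact congrArg _ r.YΨ.ext.proj_pt
  · rw [r.HΨ.compTors.incl_lift, ← genHeis_heiP, Category.assoc]
    refine (congrArg _ hHτ).trans ?_
    rw [Preadditive.comp_sub, Preadditive.comp_nsmul, ← Category.assoc _ (heiR N S),
      genHeis_heiR, Category.assoc, ← Category.assoc (symS N S), hsym, Category.id_comp,
      Category.assoc]
  · rw [r.YΨ.compTors.incl_lift, ← genYon_yonP, Category.assoc]
    refine (congrArg _ hYτ).trans ?_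
    rw [Preadditive.comp_sub, Preadditive.comp_nsmul]

namespace ResComparison

variable {f : S' ⟶ S} {I : InjectiveResolution (Mu2 N S)} {I' : InjectiveResolution (Mu2 N S')}
  (k : ResComparison f I I') {F G : CommRingCat.{u} ⥤ AddCommGrpCat.{u}} {n : ℕ}

/-- The transport along `k` of a morphism to the resolution over `S`. -/
def bc (n : ℕ) (m : shOver S F ⟶ I.cocomplex.X n) : shOver S' F ⟶ I'.cocomplex.X n :=
  bcHom f m ≫ k.κ n

theorem bc_sub (m m' : shOver S F ⟶ I.cocomplex.X n) : k.bc n (m - m') = k.bc n m - k.bc n m' := by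
  rw [bc, bcHom_sub, Preadditive.sub_comp]
  rfl

theorem bc_nsmul (a : ℕ) (m : shOver S F ⟶ I.cocomplex.X n) : k.bc n (a • m) = a • k.bc n m := by
  rw [bc, bcHom_nsmul, Preadditive.nsmul_comp]
  rfl

theorem bc_shMap_comp (α : F ⟶ G) (m : shOver S G ⟶ I.cocomplex.X n) :
    k.bc n (shMap S α ≫ m) = shMap S' α ≫ k.bc n m := by
  rw [bc, bcHom_shMap_comp, Category.assoc]
  rfl

theorem bc_comp_d (m : shOver S F ⟶ I.cocomplex.X n) :
    k.bc (n + 1) (m ≫ I.cocomplex.d n (n + 1)) = k.bc n m ≫ I'.cocomplex.d n (n + 1) := by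
  rw [bc, bcHom_comp, Category.assoc, k.comm, ← Category.assoc]
  rfl

end ResComparison

/-- The transport of `D` along a comparison of resolutions. -/
def ProductRep.Triv.baseChange {f : S' ⟶ S} {r : ProductRep N S} {r' : ProductRep N S'}
    (k : ResComparison f r.res r'.res) (D : r.Triv) :
    TrivData (kumI N S') (kumP N S') (shMap S' (genMuNat N)) (shMap S' (genHeisNat N))
      (shMap S' (genYonNat N)) (shMap S' (genGmNat N)) (r'.res.cocomplex.d 0 1)
      (shMap S' (halfSqNat N) ≫ r'.sym.inv ≫ augment r'.res) (k.bc 0 r.HΨ.ext.lift)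
      (k.bc 0 r.YΨ.ext.lift) (k.bc 1 r.HΨ.comp.lift) (k.bc 1 r.YΨ.comp.lift)
      (k.bc 0 r.HΨ.compTors.lift) (k.bc 0 r.YΨ.compTors.lift) where
  c := k.bc 0 D.c
  incl_c := by
    have h : k.bc 0 (r.sym.inv ≫ augment r.res) = r'.sym.inv ≫ augment r'.res := by
      rw [← cancel_epi r'.sym.hom, Iso.hom_inv_id_assoc, r'.sym_hom, ← k.bc_shMap_comp]
      have h' : symS N S ≫ r.sym.inv ≫ augment r.res = augment r.res := by
        rw [← r.sym_hom, Iso.hom_inv_id_assoc]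
      exact (congrArg (k.bc 0) h').trans k.augment_comm
    rw [← k.bc_shMap_comp, D.incl_c, k.bc_shMap_comp, h]
  e := k.bc 1 D.e
  pow_e := by rw [← k.bc_shMap_comp, D.pow_e, k.bc_comp_d]
  s := k.bc 0 D.s
  pow_s := by rw [← k.bc_shMap_comp, D.pow_s, k.bc_nsmul]
  q := k.bc 0 D.q
  cover_q := by
    rw [← k.bc_shMap_comp, D.cover_q, k.bc_sub, k.bc_sub, k.bc_shMap_comp, k.bc_shMap_comp,
      k.bc_shMap_comp]
  qt := k.bc 0 D.qt
  incl_qt := by rw [← k.bc_shMap_comp, D.incl_qt]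
  T := k.bc 1 D.T
  pow_T := by rw [← k.bc_shMap_comp, D.pow_T, k.bc_sub, k.bc_sub, k.bc_sub, k.bc_comp_d]
  R := k.bc 0 D.R
  pow_R := by rw [← k.bc_shMap_comp, D.pow_R, k.bc_sub, k.bc_sub, k.bc_sub, k.bc_nsmul]

/-- The isomorphism `T : B(H) ∘ Ψ ≅ B(Y_η) ∘ Ψ`. -/
def ProductRep.Triv.twoIso (hN : 1 ≤ N) (hS : IsUnit (N : Γ(S, ⊤))) {r : ProductRep N S}
    (D : r.Triv) : r.TwoIso where
  hom := D.T
  d_hom := by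
    have := (kummer_exact hN hS).epi
    exact D.T_comp_d (r.res.cocomplex.d_comp_d 0 1 2) r.HΨ.comp.proj_pt r.YΨ.comp.proj_pt

/-- The compatibility `R` of `T` with the `2`-torsion structures. -/
def ProductRep.Triv.twoIsoTors (hN : 1 ≤ N) (hS : IsUnit (N : Γ(S, ⊤))) {r : ProductRep N S}
    (D : r.Triv) : r.TwoIsoTors (D.twoIso hN hS) where
  hom := D.R
  d_hom := by
    have := (kummer_exact hN hS).epi
    exact D.R_comp_d r.HΨ.compTors.proj_htpy r.YΨ.compTors.proj_htpy

/-- The comparison `u` of two representatives of a coboundary, on a cover `W` of `μ_N` which lifts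
to the extension `E`. -/
theorem CompositeComparison.cover_u {f : S' ⟶ S} {I : InjectiveResolution (Mu2 N S)}
    {I' : InjectiveResolution (Mu2 N S')} {k : ResComparison f I I'}
    {P E W : CommRingCat.{u} ⥤ AddCommGrpCat.{u}} {i : P ⟶ E} {p : E ⟶ muFun N} {ρ : E ⟶ P}
    {a : MapsPt I (shOver S P) 0} {a' : MapsPt I' (shOver S' P) 0}
    {s : Composite (shMap S i) (shMap S p) (shMap S ρ) (kumI N S) (kumP N S) a}
    {s' : Composite (shMap S' i) (shMap S' p) (shMap S' ρ) (kumI N S') (kumP N S') a'}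
    (c : CompositeComparison k s s') {b : W ⟶ E} {π : W ⟶ muFun N} (h : b ≫ p = π) :
    shMap S' π ≫ c.u = shMap S' b ≫ (k.bc 0 s.ext.lift - s'.ext.lift) := by
  rw [← h, shMap_comp, Category.assoc, c.proj_u]
  rfl

theorem ProductRep.Triv.matches (hN : 1 ≤ N) (hS : IsUnit (N : Γ(S, ⊤)))
    (hS' : IsUnit (N : Γ(S', ⊤))) {f : S' ⟶ S} {r : ProductRep N S} {r' : ProductRep N S'}
    (k : ProductComparison f r r') (D : r.Triv) (D' : r'.Triv) :
    k.Matches (D.twoIsoTors hN hS) (D'.twoIsoTors hN hS') := by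
  have := epi_genMu hN hS'
  exact (ProductRep.Triv.baseChange k.res D).exists_comparison (kummer_exact hN hS') genGm_kumP D'
    (k.HΨ.cover_u (genHeisNat_proj N)) (k.YΨ.cover_u (genYonNat_proj N)) k.HΨ.incl_x k.YΨ.incl_x
    k.HΨ.pow_y k.YΨ.pow_y k.HΨ.pow_z k.YΨ.pow_z

end

theorem mainTheorem5 (N : ℕ) (hN : 1 ≤ N) :
    (∀ S : Scheme.{u}, IsUnit (N : Γ(S, ⊤)) →
      IsShortExact (kumI N S) (kumP N S) ∧
      IsShortExact (heiI N S) (heiP N S) ∧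
      IsShortExact (yonI N S) (yonP N S) ∧
      IsIso (symS N S) ∧
      Nonempty (ProductRep N S)) ∧
    ∃ (T : ∀ S : Scheme.{u}, IsUnit (N : Γ(S, ⊤)) → ∀ r : ProductRep N S, r.TwoIso)
      (R : ∀ (S : Scheme.{u}) (hS : IsUnit (N : Γ(S, ⊤))) (r : ProductRep N S),
        r.TwoIsoTors (T S hS r)),
      ∀ (S S' : Scheme.{u}) (hS : IsUnit (N : Γ(S, ⊤))) (hS' : IsUnit (N : Γ(S', ⊤)))
        (f : S' ⟶ S) (r : ProductRep N S) (r' : ProductRep N S') (k : ProductComparison f r r'),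
        k.Matches (R S hS r) (R S' hS' r') := by
  refine ⟨fun S hS => ⟨kummer_exact hN hS, heisenberg_exact hS, yoneda_exact hN hS,
    isIso_symS hN hS, nonempty_productRep hN hS⟩, ?_⟩
  let D (S : Scheme.{u}) (hS : IsUnit (N : Γ(S, ⊤))) (r : ProductRep N S) : r.Triv :=
    (r.nonempty_triv hN hS).some
  exact ⟨fun S hS r => (D S hS r).twoIso hN hS, fun S hS r => (D S hS r).twoIsoTors hN hS,
    fun S S' hS hS' f r r' k =>
      ProductRep.Triv.matches hN hS hS' k (D S hS r) (D S' hS' r')⟩
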